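/- **Setting.** Let $\mathcal X\subset\mathbb R^d$ be measurable, $\lambda$ the Lebesgue measure on $\mathcal X$, and let $X_1,X_2,\dots$ be i.i.d. with law $F$ on $\mathcal X$ and density $f$ with respect to $\lambda$. For a function $s:\mathcal X\to\mathbb R_+$ and $\alpha\in[0,1)$ put $\alpha_s(t)=F\{s\ge t\}$, $\lambda_s(t)=\lambda\{s\ge t\}$, $\alpha_s^{-1}(\alpha)=\inf\{t\in\mathbb R:\alpha_s(t)\le\alpha\}$, and let $\mathrm{MV}_s(\alpha)=\lambda_s(\alpha_s^{-1}(\alpha))$ be the mass volume curve of $s$. Put $\mathrm{MV}^*=\mathrm{MV}_f$ and $Q^*(\alpha)=\inf\{t: F\{f\le t\}\ge 1-\alpha\}$. A minimum volume set of mass at least $\alpha$ is a measurable $\Omega\subset\mathcal X$ that minimizes $\lambda(\Omega)$ subject to $F(\Omega)\ge\alpha$. Let $\varepsilon,\delta\in(0,1)$ and let $\mathcal G$ be a class of measurable subsets of $\mathcal X$ of finite Lebesgue measure. Let $$\mathcal R_n=\mathbb E\Big[\sup_{\Omega\in\mathcal G}\frac1n\Big|\sum_{i=1}^n\sigma_i\,\mathbb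 I\{X_i\in\Omega\}\Big|\Big],\qquad \phi_n=2\mathcal R_n+\sqrt{\frac{\log(1/\delta)}{2n}},$$ where the $\sigma_i$ are independent uniform signs, independent of the $X_i$. **Assumptions.** 1. $f$ is bounded. 2. $F\{f=t\}=0$ for all $t>0$. 3. For each $\alpha\in[0,1-\varepsilon]$ a minimum volume set of mass at least $\alpha$ belongs to $\mathcal G$. 4. There is a constant $C>0$ with $\mathcal R_n\le Cn^{-1/2}$ for all $n\ge1$. 5. $\mathrm{MV}^*$ is differentiable on $[0,1)$ with derivative $1/Q^*$, and $g=1/Q^*$ satisfies $\int_0^1(1+\log|g|)|g|\,d\alpha<\infty$. 6. There are $\gamma\ge0$ and $C>0$ such that $\sup_{q>0}\lambda\{x\in\mathcal X:|f(x)-q|\le t\}\le Ct^\gamma$ for all sufficiently small $t>0$. **Algorithm (A-Rank).** For $\alpha\in[0,1-\varepsilon]$ let $\widehat\Omega_\alpha\in\mathcal G$ be a solution of: minimize $\lambda(\Omega)$ over $\Omega\in\mathcal G$ subject to $\frac1n\#\{i\le n:X_i\in\Omega\}\ge\alpha-\phi_n$ (such solutions are assumed to exist whenever the constraint can be met). Let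 $\alpha_{j,k}=k(1-\varepsilon)/2^j$, $j_{\max}=\lfloor\log_2 n\rfloor+1$ and $$\tau=\frac{4\phi_n}{Q^*(1-\varepsilon)}+n^{-\frac{\gamma}{4(1+\gamma)}}.$$ Starting from $[\alpha_{0,0},\alpha_{0,1}]=[0,1-\varepsilon]$, recursively split a dyadic interval $[\alpha_{j,k},\alpha_{j,k+1}]$ into its two halves as long as $j<j_{\max}$ and $\lambda(\widehat\Omega_{\alpha_{j,k+1}})-\lambda(\widehat\Omega_{\alpha_{j,k}})>\tau$. Let $0=\alpha_0<\alpha_1<\dots<\alpha_{\widehat K}=1-\varepsilon$ be the endpoints of the resulting intervals, let $\widetilde\Omega_k=\bigcup_{j\le k}\widehat\Omega_{\alpha_j}$, $\widetilde\Omega_{-1}=\emptyset$, and $$\hat s(x)=\sum_{k=0}^{\widehat K}(\widehat K-k+1)\,\mathbb I\{x\in\widetilde\Omega_k\setminus\widetilde\Omega_{k-1}\}.$$ **Theorem.** There is a constant $C>0$, not depending on $n$, such that for every $n\ge1$, with probability at least $1-\delta$, $$\sup_{\alpha\in[0,1-\varepsilon],\ \alpha<F(\widetilde\Omega_{\widehat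 K})}\big\{\mathrm{MV}_{\hat s}(\alpha)-\mathrm{MV}^*(\alpha)\big\}\le C\,n^{-\frac{\gamma}{4(1+\gamma)}}.$$ Moreover, on the same event $F(\widetilde\Omega_{\widehat K})\ge1-\varepsilon-2\phi_n$, and $\lambda(\widetilde\Omega_{\widehat K})-\mathrm{MV}^*(\alpha)\le C\,n^{-\frac{\gamma}{4(1+\gamma)}}$ for all $\alpha\in[0,1-\varepsilon]$ with $\alpha\ge F(\widetilde\Omega_{\widehat K})$. -/

import Mathlib

open MeasureTheory ProbabilityTheory Set

noncomputable section

namespace AnomalyRanking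

variable {E : Type*} [MeasurableSpace E]

/-! Throughout, `vol` is the volume on the feature space (Lebesgue measure restricted to it) and
`F` is the distribution of the observations. -/

/-- The generalized inverse `α_s⁻¹(α) = inf {t ∈ ℝ : α_s(t) ≤ α}` of the mass function
`α_s(t) = F {s ≥ t}`. -/
def massInv (F : Measure E) (s : E → ℝ) (α : ℝ) : ℝ :=
  sInf {t : ℝ | F.real {x | t ≤ s x} ≤ α}

/-- The Mass Volume curve `MV_s(α) = λ_s(α_s⁻¹(α))`, where `λ_s(t)` is the volume of `{s ≥ t}`. -/
def massVolume (vol F : Measure E) (s : E → ℝ) (α : ℝ) : ENNReal :=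
  vol {x | massInv F s α ≤ s x}

/-- `Q(s, α)`, the quantile at level `1 - α` of the distribution of `s(X)`. -/
def upperQuantile (F : Measure E) (s : E → ℝ) (α : ℝ) : ℝ :=
  sInf {t : ℝ | 1 - α ≤ F.real {x | s x ≤ t}}

/-- `Ω` is a minimum volume set of mass at least `α`. -/
def IsMinVolumeSet (vol F : Measure E) (α : ℝ) (Ω : Set E) : Prop :=
  MeasurableSet Ω ∧ α ≤ F.real Ω ∧
    ∀ Ω' : Set E, MeasurableSet Ω' → α ≤ F.real Ω' → vol Ω ≤ vol Ω'

/-- The empirical mass of `Ω` for the sample `x`. -/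
def empMass {n : ℕ} (x : Fin n → E) (Ω : Set E) : ℝ :=
  (∑ i, Ω.indicator (fun _ => (1 : ℝ)) (x i)) / n

/-- `Ω` satisfies the constraint of the empirical minimum volume set problem over the class `G`. -/
def IsEmpFeasible (G : Set (Set E)) {n : ℕ} (x : Fin n → E) (φ α : ℝ) (Ω : Set E) : Prop :=
  Ω ∈ G ∧ α - φ ≤ empMass x Ω

/-- `Ω` solves the empirical minimum volume set problem over the class `G`, at mass level `α` and
with penalty `φ`. -/
def IsEmpMinVolumeSet (vol : Measure E) (G : Set (Set E)) {n : ℕ} (x : Fin n → E) (φ α : ℝ)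
    (Ω : Set E) : Prop :=
  IsEmpFeasible G x φ α Ω ∧ ∀ Ω', IsEmpFeasible G x φ α Ω' → vol Ω ≤ vol Ω'

/-- The usual measurability condition on a class of sets: all weighted suprema over the class are
measurable functions of the sample. -/
def IsMeasurableClass (G : Set (Set E)) : Prop :=
  ∀ (n : ℕ) (e : Fin n → ℝ), Measurable fun x : Fin n → E =>
    ⨆ Ω : G, |∑ i, e i * (Ω : Set E).indicator (fun _ => (1 : ℝ)) (x i)|

/-- The Rademacher average of `G`: the expectation, over `n` independent draws from `F` and over
`n` independent uniform signs, of `sup_{Ω ∈ G} (1/n) |∑ i, σ i * 1{X i ∈ Ω}|`. -/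
def rademacherAverage (F : Measure E) (G : Set (Set E)) (n : ℕ) : ℝ :=
  ∫ x : Fin n → E,
    (∑ σ : Fin n → ℤˣ,
      ⨆ Ω : G, (1 / (n : ℝ)) *
        |∑ i, ((σ i : ℤ) : ℝ) * (Ω : Set E).indicator (fun _ => (1 : ℝ)) (x i)|) / 2 ^ n
    ∂(Measure.pi fun _ => F)

/-- `φ_n(δ) = 2 R_n + √(log(1/δ) / (2n))`. -/
def penalty (F : Measure E) (G : Set (Set E)) (n : ℕ) (δ : ℝ) : ℝ :=
  2 * rademacherAverage F G n + Real.sqrt (Real.log (1 / δ) / (2 * n))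

/-- Membership in `L log L` on `(0,1)`. As `(1 + log u) u` is bounded below for `u ≥ 0`, finiteness
of the integral is integrability. -/
def MemLLogL (g : ℝ → ℝ) : Prop :=
  AEMeasurable g (volume.restrict (Ioo 0 1)) ∧
    IntegrableOn (fun α => (1 + Real.log |g α|) * |g α|) (Ioo 0 1)

/-- The dyadic level `α_{j,k} = k (1 - ε) / 2^j`. -/
def dyadicLevel (ε : ℝ) (j k : ℕ) : ℝ := k * (1 - ε) / 2 ^ j

/-- The empirical local error on the dyadic interval `I_{j,k} = [α_{j,k}, α_{j,k+1}]`. -/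
def empLocalError (vol : Measure E) (Ωhat : ℝ → Set E) (ε : ℝ) (j k : ℕ) : ℝ :=
  vol.real (Ωhat (dyadicLevel ε j (k + 1))) - vol.real (Ωhat (dyadicLevel ε j k))

open Classical in
/-- The leaves, from left to right, of the dyadic tree grown from the node `(j, k)`: a node is split
into `(j + 1, 2k)` and `(j + 1, 2k + 1)` when `split` tells so and the maximal depth is not reached.
The first argument is the number of generations that remain before the maximal depth. -/
def adaptiveLeaves (split : ℕ → ℕ → Prop) : ℕ → ℕ → ℕ → List (ℕ × ℕ)
  | 0, j, k => [(j, k)]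
  | m + 1, j, k =>
      if split j k then
        adaptiveLeaves split m (j + 1) (2 * k) ++ adaptiveLeaves split m (j + 1) (2 * k + 1)
      else [(j, k)]

/-- The breakpoints `0 = α_0 < α_1 < ... < α_K = 1 - ε` output by the adaptive estimation algorithm
with tolerance `τ` and maximal depth `⌊log n / log 2⌋ + 1`: `0` and the right endpoints of the
leaves. -/
def adaptiveBreakpoints (vol : Measure E) (Ωhat : ℝ → Set E) (ε τ : ℝ) (n : ℕ) : List ℝ :=
  0 :: (adaptiveLeaves (fun j k => τ < empLocalError vol Ωhat ε j k) (Nat.log 2 n + 1) 0 0).map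
    fun p => dyadicLevel ε p.1 (p.2 + 1)

/-- Monotonicity step: `Ω̃_0 = Ω̂_0` and `Ω̃_{k+1} = Ω̂_{k+1} ∪ Ω̃_k`. -/
def monotoneSets (S : ℕ → Set E) : ℕ → Set E
  | 0 => S 0
  | k + 1 => S (k + 1) ∪ monotoneSets S k

/-- The layers `Ω̃_k \ Ω̃_{k-1}`, with `Ω̃_{-1} = ∅`. -/
def layer (T : ℕ → Set E) : ℕ → Set E
  | 0 => T 0
  | k + 1 => T (k + 1) \ T k

/-- The scoring function `∑_{k=0}^K (K - k + 1) 1{x ∈ Ω̃_k \ Ω̃_{k-1}}`. -/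
def overlayScore (T : ℕ → Set E) (K : ℕ) (x : E) : ℝ :=
  ∑ k ∈ Finset.range (K + 1), ((K : ℝ) - k + 1) * (layer T k).indicator (fun _ => (1 : ℝ)) x

/-- The scoring function output by A-Rank, from the estimated minimum volume sets `Ωhat α`, with
tolerance `τ` and sample size `n`. -/
def aRankScore (vol : Measure E) (Ωhat : ℝ → Set E) (ε τ : ℝ) (n : ℕ) : E → ℝ :=
  overlayScore
    (monotoneSets fun k => Ωhat ((adaptiveBreakpoints vol Ωhat ε τ n).getD k 0))
    ((adaptiveBreakpoints vol Ωhat ε τ n).length - 1)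

end AnomalyRanking

end

/-! ### McDiarmid's inequality. -/

namespace AnomalyRanking

variable {E : Type*} [MeasurableSpace E]

/-! The sample enters through a single event. If every `Ω ∈ G` has empirical mass within `φ` of its
mass, a true minimum volume set is feasible, so `Ωhat α` has at most the volume of the superlevel
set `L α` of `f` of mass `α`, and mass at least `α - 2φ`
(`isNearOptimalFamily_of_uniformDeviation`). McDiarmid's inequality and symmetrization give this
event probability at least `1 - δ` (`exists_uniformDeviation_event`). The rest is deterministic.

Write `Q = Q*(1 - ε)` and `r = n ^ (-γ / (4 (1 + γ)))`. By the margin condition, `Ωhat α \ L α` has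
volume at most some `e = O(φ ^ (γ / (1 + γ)))`. Superlevel sets are nested, so the `k`-th union of
estimates exceeds `L α_k` by a volume of at most `(K + 1) e`. On `[0, 1 - ε]` the optimal curve is
Lipschitz with constant `1 / Q`; hence a split interval is longer than `Q r`, which bounds `K` by a
multiple of `1 / r`, while on a leaf the optimal curve varies by `O(φ + r + 1 / n)`.

The curve of the score at `α` is the volume of the first union of mass larger than `α`. The union
before it has mass at most `α`, so its level is at most `α + 2φ`, and one leaf separates the two
(`aRankScore_bounds`). As `φ = O(n ^ (-1/2))` gives `e = O(r ^ 2)`, every error term is `O(r)`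
(`error_terms_le`). -/

theorem measurePreserving_finCons (F : Measure E) [IsProbabilityMeasure F] (n : ℕ) :
    MeasurePreserving (fun p : (Fin n → E) × E => (Fin.cons p.2 p.1 : Fin (n + 1) → E))
      ((Measure.pi fun _ : Fin n => F).prod F) (Measure.pi fun _ : Fin (n + 1) => F) := by
  have h := ((measurePreserving_piFinSuccAbove (fun _ : Fin (n + 1) => F) 0).symm).comp
    (Measure.measurePreserving_swap (μ := Measure.pi fun _ : Fin n => F) (ν := F))
  convert h using 1
  funext p
  simp [MeasurableEquiv.piFinSuccAbove, Fin.insertNthEquiv]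

theorem integrable_of_measurable_of_abs_le {Ω : Type*} [MeasurableSpace Ω] {μ : Measure Ω}
    [IsFiniteMeasure μ] {g : Ω → ℝ} (hg : Measurable g) {M : ℝ} (hM : ∀ x, |g x| ≤ M) :
    Integrable g μ :=
  Integrable.of_bound hg.aestronglyMeasurable M (Filter.Eventually.of_forall hM)

/-- A function with oscillation at most `c` is, once centered, sub-Gaussian. -/
theorem hasSubgaussianMGF_of_oscillation_le (F : Measure E) [IsProbabilityMeasure F] {g : E → ℝ}
    (hg : Measurable g) {M : ℝ} (hM : ∀ x, |g x| ≤ M) {c : NNReal}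
    (hd : ∀ x y, |g x - g y| ≤ c) :
    HasSubgaussianMGF (fun x => g x - ∫ y, g y ∂F) ((c / 2) ^ 2) F := by
  have : Nonempty E := nonempty_of_isProbabilityMeasure F
  have hb : BddBelow (range g) := ⟨-M, by rintro _ ⟨x, rfl⟩; exact (abs_le.1 (hM x)).1⟩
  have h := hasSubgaussianMGF_of_mem_Icc (μ := F) (X := g) (a := ⨅ x, g x) (b := (⨅ x, g x) + c)
    hg.aemeasurable (Filter.Eventually.of_forall fun x => ⟨ciInf_le hb x, by
      have : g x - c ≤ ⨅ y, g y := le_ciInf fun y => by linarith [(abs_le.1 (hd x y)).2]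
      linarith⟩)
  simpa using h

/-- **McDiarmid's inequality**, as a bound on the moment generating function. -/
theorem hasSubgaussianMGF_of_boundedDifferences (F : Measure E) [IsProbabilityMeasure F]
    (c : NNReal) (M : ℝ) : ∀ (n : ℕ) (g : (Fin n → E) → ℝ), Measurable g → (∀ x, |g x| ≤ M) →
      (∀ x i y, |g (Function.update x i y) - g x| ≤ c) →
      HasSubgaussianMGF (fun x => g x - ∫ y, g y ∂(Measure.pi fun _ => F)) (n * (c / 2) ^ 2)
        (Measure.pi fun _ => F) := by
  intro n
  induction n with
  | zero =>
    intro g hg hM hd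
    have h : (fun x => g x - ∫ y, g y ∂(Measure.pi fun _ : Fin 0 => F)) = fun _ => 0 := by
      funext x
      have : g = fun _ => g x := by
        funext y
        rw [Subsingleton.elim y x]
      rw [this]
      simp
    rw [h]
    simp
  | succ n ih =>
    intro g hg hM hd
    set μ := Measure.pi fun _ : Fin n => F
    have hmp := measurePreserving_finCons F n
    have hH : Measurable fun p : (Fin n → E) × E => g (Fin.cons p.2 p.1) := hg.comp hmp.measurable
    have hHint : Integrable (fun p : (Fin n → E) × E => g (Fin.cons p.2 p.1)) (μ.prod F) :=
      integrable_of_measurable_of_abs_le hH fun p => hM _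
    have hsec : ∀ x : Fin n → E, Measurable fun a => g (Fin.cons a x) := fun x =>
      hH.comp measurable_prodMk_left
    -- Coordinate `0` is integrated out. The average keeps the bound `M` and the differences `c` in
    -- the other coordinates, so the induction hypothesis applies to it.
    set k : (Fin n → E) → ℝ := fun x => ∫ a, g (Fin.cons a x) ∂F with hk
    have hkm : Measurable k := hH.stronglyMeasurable.integral_prod_right'.measurable
    have hkM : ∀ x, |k x| ≤ M := fun x => by
      have := norm_integral_le_of_norm_le_const (μ := F) (C := M)
        (f := fun a => g (Fin.cons a x)) (Filter.Eventually.of_forall fun a => hM _)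
      simpa using this
    have hkd : ∀ x i y, |k (Function.update x i y) - k x| ≤ c := fun x i y => by
      have hi : ∀ x : Fin n → E, Integrable (fun a => g (Fin.cons a x)) F := fun x =>
        integrable_of_measurable_of_abs_le (hsec x) fun _ => hM _
      have h0 : k (Function.update x i y) - k x
          = ∫ a, (g (Fin.cons a (Function.update x i y)) - g (Fin.cons a x)) ∂F :=
        (integral_sub (hi _) (hi _)).symm
      rw [h0]
      have := norm_integral_le_of_norm_le_const (μ := F) (C := c)
        (f := fun a => g (Fin.cons a (Function.update x i y)) - g (Fin.cons a x))
        (Filter.Eventually.of_forall fun a => by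
          have h1 := hd (Fin.cons a x) i.succ y
          rw [← Fin.cons_update] at h1
          exact h1)
      simpa using this
    have hkI := ih k hkm hkM hkd
    have hmean : ∫ x, k x ∂μ = ∫ y, g y ∂(Measure.pi fun _ : Fin (n + 1) => F) := by
      rw [← hmp.map_eq, integral_map hmp.measurable.aemeasurable hg.aestronglyMeasurable,
        integral_prod _ hHint]
    set m := ∫ y, g y ∂(Measure.pi fun _ : Fin (n + 1) => F)
    rw [hmean] at hkI
    have hexpb : ∀ (t : ℝ) x, |Real.exp (t * (g x - m))| ≤ Real.exp (|t| * (M + |m|)) := by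
      intro t x
      rw [abs_of_pos (Real.exp_pos _)]
      refine Real.exp_le_exp.2 ((le_abs_self _).trans ?_)
      rw [abs_mul]
      exact mul_le_mul_of_nonneg_left ((abs_sub _ _).trans (by gcongr; exact hM x)) (abs_nonneg _)
    have hexpm : ∀ t : ℝ, Measurable fun x => Real.exp (t * (g x - m)) := fun t => by fun_prop
    refine ⟨fun t => integrable_of_measurable_of_abs_le (hexpm t) (hexpb t), fun t => ?_⟩
    have hint : Integrable (fun p : (Fin n → E) × E => Real.exp (t * (g (Fin.cons p.2 p.1) - m)))
        (μ.prod F) :=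
      integrable_of_measurable_of_abs_le ((hexpm t).comp hmp.measurable) fun p => hexpb t _
    -- With the other coordinates frozen, `g` oscillates by at most `c` in coordinate `0`:
    -- Hoeffding's lemma yields one more factor.
    have hinner : ∀ x : Fin n → E, ∫ a, Real.exp (t * (g (Fin.cons a x) - m)) ∂F
        ≤ Real.exp (((c / 2 : NNReal) ^ 2 : NNReal) * t ^ 2 / 2) * Real.exp (t * (k x - m)) := by
      intro x
      have h1 := (hasSubgaussianMGF_of_oscillation_le F (hsec x) (fun a => hM _) (c := c)
        (fun a b => by
          have h1 := hd (Fin.cons b x) 0 a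
          rwa [Fin.update_cons_zero] at h1)).mgf_le t
      have h2 : ∫ a, Real.exp (t * (g (Fin.cons a x) - m)) ∂F
          = mgf (fun a => g (Fin.cons a x) - ∫ b, g (Fin.cons b x) ∂F) F t
            * Real.exp (t * (k x - m)) := by
        rw [mgf, ← integral_mul_const]
        refine integral_congr_ae (Filter.Eventually.of_forall fun a => ?_)
        simp only [← Real.exp_add, hk]
        congr 1
        ring
      rw [h2]
      exact mul_le_mul_of_nonneg_right h1 (Real.exp_pos _).le
    calc mgf (fun x => g x - m) (Measure.pi fun _ : Fin (n + 1) => F) t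
        = ∫ x, ∫ a, Real.exp (t * (g (Fin.cons a x) - m)) ∂F ∂μ := by
          rw [mgf, ← hmp.map_eq, integral_map hmp.measurable.aemeasurable
            (hexpm t).aestronglyMeasurable, integral_prod _ hint]
      _ ≤ ∫ x, Real.exp (((c / 2 : NNReal) ^ 2 : NNReal) * t ^ 2 / 2)
            * Real.exp (t * (k x - m)) ∂μ :=
          integral_mono hint.integral_prod_left ((hkI.integrable_exp_mul t).const_mul _) hinner
      _ = Real.exp (((c / 2 : NNReal) ^ 2 : NNReal) * t ^ 2 / 2) * mgf (fun x => k x - m) μ t := by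
          rw [integral_const_mul, mgf]
      _ ≤ Real.exp (((c / 2 : NNReal) ^ 2 : NNReal) * t ^ 2 / 2)
            * Real.exp ((n * (c / 2) ^ 2 : NNReal) * t ^ 2 / 2) :=
          mul_le_mul_of_nonneg_left (hkI.mgf_le t) (Real.exp_pos _).le
      _ = Real.exp (((n + 1 : ℕ) * (c / 2) ^ 2 : NNReal) * t ^ 2 / 2) := by
          rw [← Real.exp_add]
          congr 1
          push_cast
          ring

end AnomalyRanking

/-! ### Symmetrization and uniform deviations over the class. -/

namespace AnomalyRanking

variable {E : Type*}

/-- The largest weighted count over the class `G`. -/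
noncomputable def weightedSup (G : Set (Set E)) {n : ℕ} (e : Fin n → ℝ) (x : Fin n → E) : ℝ :=
  ⨆ Ω : G, |∑ i, e i * (Ω : Set E).indicator (fun _ => (1 : ℝ)) (x i)|

theorem abs_indicator_one_le (Ω : Set E) (x : E) : |Ω.indicator (fun _ => (1 : ℝ)) x| ≤ 1 := by
  by_cases h : x ∈ Ω <;> simp [h]

theorem abs_weightedSum_le (Ω : Set E) {n : ℕ} (e : Fin n → ℝ) (x : Fin n → E) :
    |∑ i, e i * Ω.indicator (fun _ => (1 : ℝ)) (x i)| ≤ ∑ i, |e i| := by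
  refine (Finset.abs_sum_le_sum_abs _ _).trans (Finset.sum_le_sum fun i _ => ?_)
  rw [abs_mul]
  exact mul_le_of_le_one_right (abs_nonneg _) (abs_indicator_one_le _ _)

theorem bddAbove_weightedSum (G : Set (Set E)) {n : ℕ} (e : Fin n → ℝ) (x : Fin n → E) :
    BddAbove (range fun Ω : G => |∑ i, e i * (Ω : Set E).indicator (fun _ => (1 : ℝ)) (x i)|) :=
  ⟨∑ i, |e i|, by rintro _ ⟨Ω, rfl⟩; exact abs_weightedSum_le _ _ _⟩

theorem le_weightedSup {G : Set (Set E)} {n : ℕ} (e : Fin n → ℝ) (x : Fin n → E) {Ω : Set E}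
    (hΩ : Ω ∈ G) : |∑ i, e i * Ω.indicator (fun _ => (1 : ℝ)) (x i)| ≤ weightedSup G e x :=
  le_ciSup (bddAbove_weightedSum G e x) ⟨Ω, hΩ⟩

theorem weightedSup_nonneg (G : Set (Set E)) {n : ℕ} (e : Fin n → ℝ) (x : Fin n → E) :
    0 ≤ weightedSup G e x :=
  Real.iSup_nonneg fun _ => abs_nonneg _

theorem abs_weightedSup_le (G : Set (Set E)) {n : ℕ} (e : Fin n → ℝ) (x : Fin n → E) :
    |weightedSup G e x| ≤ ∑ i, |e i| := by
  rw [abs_of_nonneg (weightedSup_nonneg G e x)]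
  exact Real.iSup_le (fun Ω => abs_weightedSum_le _ _ _) (Finset.sum_nonneg fun _ _ => abs_nonneg _)

/-- The largest gap, over the class `G`, between the empirical masses of two samples. -/
noncomputable def ghostDeviation (G : Set (Set E)) {n : ℕ} (p : (Fin n → E) × (Fin n → E)) : ℝ :=
  weightedSup G (Fin.append (fun _ => 1 / (n : ℝ)) fun _ => -(1 / (n : ℝ)))
    (Fin.append p.1 p.2)

theorem weightedSum_append (Ω : Set E) {n : ℕ} (x y : Fin n → E) :
    ∑ i, (Fin.append (fun _ => 1 / (n : ℝ)) fun _ : Fin n => -(1 / (n : ℝ))) i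
      * Ω.indicator (fun _ => (1 : ℝ)) (Fin.append x y i) = empMass x Ω - empMass y Ω := by
  rw [Fin.sum_univ_add]
  simp only [Fin.append_left, Fin.append_right, empMass, neg_mul, Finset.sum_neg_distrib,
    ← Finset.mul_sum]
  ring

theorem ghostDeviation_eq (G : Set (Set E)) {n : ℕ} (x y : Fin n → E) :
    ghostDeviation G (x, y) = ⨆ Ω : G, |empMass x (Ω : Set E) - empMass y (Ω : Set E)| := by
  simp only [ghostDeviation, weightedSup, weightedSum_append]

theorem abs_empMass_sub_le_ghostDeviation {G : Set (Set E)} {n : ℕ} (x y : Fin n → E) {Ω : Set E}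
    (hΩ : Ω ∈ G) : |empMass x Ω - empMass y Ω| ≤ ghostDeviation G (x, y) := by
  rw [← weightedSum_append]
  exact le_weightedSup _ _ hΩ

theorem abs_ghostDeviation_le (G : Set (Set E)) {n : ℕ} (p : (Fin n → E) × (Fin n → E)) :
    |ghostDeviation G p| ≤ 2 := by
  refine (abs_weightedSup_le _ _ _).trans ?_
  rw [Fin.sum_univ_add]
  simp only [Fin.append_left, Fin.append_right, abs_neg, Finset.sum_const, Finset.card_univ,
    Fintype.card_fin, nsmul_eq_mul]
  rcases Nat.eq_zero_or_pos n with rfl | hn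
  · simp
  · have : (0 : ℝ) < n := by exact_mod_cast hn
    rw [abs_of_pos (by positivity)]
    field_simp
    norm_num

theorem empMass_update_sub_le {n : ℕ} (x : Fin n → E) (i : Fin n) (a : E) (Ω : Set E) :
    |empMass (Function.update x i a) Ω - empMass x Ω| ≤ 1 / n := by
  have hn : (0 : ℝ) < n := by exact_mod_cast i.pos
  have h : ∑ j, Ω.indicator (fun _ => (1 : ℝ)) (Function.update x i a j)
      - ∑ j, Ω.indicator (fun _ => (1 : ℝ)) (x j)
      = Ω.indicator (fun _ => (1 : ℝ)) a - Ω.indicator (fun _ => (1 : ℝ)) (x i) := by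
    rw [← Finset.sum_sub_distrib, Finset.sum_eq_single i]
    · simp
    · intro j _ hj
      simp [Function.update_of_ne hj]
    · simp
  rw [empMass, empMass, ← sub_div, h, abs_div, abs_of_pos hn]
  gcongr
  by_cases h1 : a ∈ Ω <;> by_cases h2 : x i ∈ Ω <;> simp [h1, h2]

/-- Replacing one observation moves each gap by at most `1 / n`, hence also their supremum. The
one-sided bound `key` is used in both directions. -/
theorem ghostDeviation_update_sub_le (G : Set (Set E)) {n : ℕ} (x y : Fin n → E) (i : Fin n)
    (a : E) : |ghostDeviation G (Function.update x i a, y) - ghostDeviation G (x, y)| ≤ 1 / n := by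
  have key : ∀ x x' : Fin n → E, (∀ Ω, |empMass x' Ω - empMass x Ω| ≤ 1 / n) →
      ghostDeviation G (x', y) ≤ ghostDeviation G (x, y) + 1 / n := by
    intro x x' h
    rw [ghostDeviation_eq G x' y]
    refine Real.iSup_le (fun Ω => ?_)
      (add_nonneg (weightedSup_nonneg _ _ _) (by positivity))
    have h1 := abs_empMass_sub_le_ghostDeviation x y Ω.2
    have h2 := abs_sub_le (empMass x' (Ω : Set E)) (empMass x (Ω : Set E)) (empMass y (Ω : Set E))
    linarith [h Ω]
  have h1 := key x _ fun Ω => empMass_update_sub_le x i a Ω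
  have h2 := key (Function.update x i a) x fun Ω => by
    rw [abs_sub_comm]
    exact empMass_update_sub_le x i a Ω
  rw [abs_le]
  constructor <;> linarith

/-- Exchange, in two samples, the observations whose sign is not `1`. -/
def signSwap {n : ℕ} (σ : Fin n → ℤˣ) (p : (Fin n → E) × (Fin n → E)) :
    (Fin n → E) × (Fin n → E) :=
  (fun i => if σ i = 1 then p.1 i else p.2 i, fun i => if σ i = 1 then p.2 i else p.1 i)

theorem empMass_signSwap_sub {n : ℕ} (σ : Fin n → ℤˣ) (p : (Fin n → E) × (Fin n → E)) (Ω : Set E) :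
    empMass (signSwap σ p).1 Ω - empMass (signSwap σ p).2 Ω
      = ∑ i, (((σ i : ℤ) : ℝ) / n) * Ω.indicator (fun _ => (1 : ℝ)) (p.1 i)
        - ∑ i, (((σ i : ℤ) : ℝ) / n) * Ω.indicator (fun _ => (1 : ℝ)) (p.2 i) := by
  rw [empMass, empMass, ← sub_div, ← Finset.sum_sub_distrib, ← Finset.sum_sub_distrib,
    Finset.sum_div]
  refine Finset.sum_congr rfl fun i _ => ?_
  rcases Int.units_eq_one_or (σ i) with h | h
  · simp [signSwap, h]
    ring
  · have : (-1 : ℤˣ) ≠ 1 := by decide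
    simp [signSwap, h, this]
    ring

/-- Exchanging the `i`-th observations multiplies the `i`-th difference of indicators by `σ i`, so
the gap becomes a signed sum over one sample minus a signed sum over the other. -/
theorem ghostDeviation_signSwap_le (G : Set (Set E)) {n : ℕ} (σ : Fin n → ℤˣ)
    (p : (Fin n → E) × (Fin n → E)) :
    ghostDeviation G (signSwap σ p)
      ≤ weightedSup G (fun i => ((σ i : ℤ) : ℝ) / n) p.1
        + weightedSup G (fun i => ((σ i : ℤ) : ℝ) / n) p.2 := by
  rw [← Prod.mk.eta (p := signSwap σ p), ghostDeviation_eq]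
  refine Real.iSup_le (fun Ω => ?_)
    (add_nonneg (weightedSup_nonneg _ _ _) (weightedSup_nonneg _ _ _))
  rw [empMass_signSwap_sub]
  exact (abs_sub _ _).trans (add_le_add (le_weightedSup _ _ Ω.2) (le_weightedSup _ _ Ω.2))

variable [MeasurableSpace E]

/-- The gap is a weighted count over the concatenated sample of size `2n`, to which the
measurability condition on the class applies. -/
theorem measurable_ghostDeviation {G : Set (Set E)} (hG : IsMeasurableClass G) (n : ℕ) :
    Measurable fun p : (Fin n → E) × (Fin n → E) => ghostDeviation G p := by
  refine (hG (n + n) _).comp (measurable_pi_lambda _ fun i => ?_)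
  refine Fin.addCases (fun j => ?_) (fun j => ?_) i
  · simp only [Fin.append_left]; fun_prop
  · simp only [Fin.append_right]; fun_prop

theorem integral_empMass (F : Measure E) [IsProbabilityMeasure F] {n : ℕ} (hn : 1 ≤ n) {Ω : Set E}
    (hΩ : MeasurableSet Ω) : ∫ y : Fin n → E, empMass y Ω ∂(Measure.pi fun _ => F) = F.real Ω := by
  have hn' : (n : ℝ) ≠ 0 := by positivity
  have hi : ∀ i : Fin n, ∫ y : Fin n → E, Ω.indicator (fun _ => (1 : ℝ)) (y i)
      ∂(Measure.pi fun _ => F) = F.real Ω := fun i => by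
    have h := (measurePreserving_eval (fun _ : Fin n => F) i)
    have hm : Measurable (Ω.indicator fun _ : E => (1 : ℝ)) := measurable_const.indicator hΩ
    have h2 := integral_map (μ := Measure.pi fun _ : Fin n => F) h.measurable.aemeasurable
      (f := Ω.indicator fun _ : E => (1 : ℝ)) hm.aestronglyMeasurable
    rw [h.map_eq] at h2
    simp only [Function.eval] at h2
    rw [← h2, integral_indicator_const _ hΩ]
    simp
  simp only [empMass]
  rw [integral_div, integral_finsetSum]
  · simp [hi, hn']
  · intro i _
    exact integrable_of_measurable_of_abs_le
      ((measurable_const.indicator hΩ).comp (measurable_pi_apply i)) fun y =>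
        abs_indicator_one_le _ _

/-- Two samples of size `n` are `n` independent pairs, and exchanging the members of a pair
preserves `F.prod F`. -/
theorem measurePreserving_signSwap (F : Measure E) [IsProbabilityMeasure F] {n : ℕ}
    (σ : Fin n → ℤˣ) :
    MeasurePreserving (signSwap (E := E) σ)
      ((Measure.pi fun _ => F).prod (Measure.pi fun _ => F))
      ((Measure.pi fun _ => F).prod (Measure.pi fun _ => F)) := by
  have h0 := measurePreserving_arrowProdEquivProdArrow E E (Fin n) (fun _ => F) (fun _ => F)
  have h1 : MeasurePreserving
      (fun (a : Fin n → E × E) i => (if σ i = 1 then id else Prod.swap) (a i))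
      (Measure.pi fun _ : Fin n => F.prod F) (Measure.pi fun _ : Fin n => F.prod F) := by
    refine measurePreserving_pi _ _ (f := fun i => if σ i = 1 then id else Prod.swap) fun i => ?_
    split_ifs
    · exact MeasurePreserving.id _
    · exact Measure.measurePreserving_swap
  have h2 := (h0.comp h1).comp h0.symm
  convert h2 using 1
  funext p
  refine Prod.ext (funext fun i => ?_) (funext fun i => ?_) <;>
  · by_cases h : σ i = 1 <;>
      simp [signSwap, h, MeasurableEquiv.arrowProdEquivProdArrow, Equiv.arrowProdEquivProdArrow]

theorem rademacherAverage_eq (F : Measure E) [IsProbabilityMeasure F] {G : Set (Set E)}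
    (hG : IsMeasurableClass G) (n : ℕ) :
    rademacherAverage F G n = (∑ σ : Fin n → ℤˣ, ∫ x : Fin n → E,
      weightedSup G (fun i => ((σ i : ℤ) : ℝ) / n) x ∂(Measure.pi fun _ => F)) / 2 ^ n := by
  have h : ∀ (σ : Fin n → ℤˣ) (x : Fin n → E),
      (⨆ Ω : G, (1 / (n : ℝ)) *
        |∑ i, ((σ i : ℤ) : ℝ) * (Ω : Set E).indicator (fun _ => (1 : ℝ)) (x i)|)
      = weightedSup G (fun i => ((σ i : ℤ) : ℝ) / n) x := by
    intro σ x
    rw [weightedSup]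
    congr 1
    funext Ω
    rw [← abs_of_nonneg (show (0 : ℝ) ≤ 1 / n by positivity), ← abs_mul, Finset.mul_sum]
    congr 1
    exact Finset.sum_congr rfl fun i _ => by ring
  simp only [rademacherAverage, h]
  rw [integral_div, integral_finsetSum]
  intro σ _
  exact integrable_of_measurable_of_abs_le (hG n _) fun x => abs_weightedSup_le G _ x

/-- **Symmetrization**. -/
theorem integral_ghostDeviation_le (F : Measure E) [IsProbabilityMeasure F] {G : Set (Set E)}
    (hG : IsMeasurableClass G) (n : ℕ) :
    ∫ p, ghostDeviation G p
      ∂((Measure.pi fun _ : Fin n => F).prod (Measure.pi fun _ : Fin n => F))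
      ≤ 2 * rademacherAverage F G n := by
  set μ := Measure.pi fun _ : Fin n => F
  have hσ : ∀ σ : Fin n → ℤˣ, ∫ p, ghostDeviation G p ∂(μ.prod μ)
      ≤ 2 * ∫ x, weightedSup G (fun i => ((σ i : ℤ) : ℝ) / n) x ∂μ := by
    intro σ
    have hmp := measurePreserving_signSwap F σ
    have hw : Integrable (weightedSup G fun i => ((σ i : ℤ) : ℝ) / n) μ :=
      integrable_of_measurable_of_abs_le (hG n _) fun x => abs_weightedSup_le G _ x
    have hw1 := hw.comp_fst μ
    have hw2 := hw.comp_snd μ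
    calc ∫ p, ghostDeviation G p ∂(μ.prod μ)
        = ∫ p, ghostDeviation G (signSwap σ p) ∂(μ.prod μ) := by
          rw [← integral_map hmp.measurable.aemeasurable
            (measurable_ghostDeviation hG n).aestronglyMeasurable, hmp.map_eq]
      _ ≤ ∫ p : (Fin n → E) × (Fin n → E), (weightedSup G (fun i => ((σ i : ℤ) : ℝ) / n) p.1
            + weightedSup G (fun i => ((σ i : ℤ) : ℝ) / n) p.2) ∂(μ.prod μ) :=
          integral_mono (integrable_of_measurable_of_abs_le
            ((measurable_ghostDeviation hG n).comp hmp.measurable)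
            fun p => abs_ghostDeviation_le G _) (hw1.add hw2)
            fun p => ghostDeviation_signSwap_le G σ p
      _ = 2 * ∫ x, weightedSup G (fun i => ((σ i : ℤ) : ℝ) / n) x ∂μ := by
          rw [integral_add hw1 hw2, integral_fun_fst, integral_fun_snd]
          simp
          ring
  -- The left side does not depend on `σ`; averaging over the `2 ^ n` sign vectors produces the
  -- Rademacher average.
  have hsum := Finset.sum_le_sum fun σ (_ : σ ∈ (Finset.univ : Finset (Fin n → ℤˣ))) => hσ σ
  rw [Finset.sum_const, ← Finset.mul_sum, Finset.card_univ, nsmul_eq_mul] at hsum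
  have hc : Fintype.card (Fin n → ℤˣ) = 2 ^ n := by simp
  rw [hc] at hsum
  rw [rademacherAverage_eq F hG n, ← mul_div_assoc, le_div_iff₀ (by positivity)]
  push_cast at hsum
  linarith

/-- With probability at least `1 - δ`, the empirical mass is within the penalty of the mass,
uniformly over the class. -/
theorem exists_uniformDeviation_event (F : Measure E) [IsProbabilityMeasure F] {G : Set (Set E)}
    (hG : IsMeasurableClass G) (hGm : ∀ Ω ∈ G, MeasurableSet Ω) {n : ℕ} (hn : 1 ≤ n) {δ : ℝ}
    (hδ : δ ∈ Ioo (0 : ℝ) 1) :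
    ∃ B : Set (Fin n → E), MeasurableSet B ∧
      ENNReal.ofReal (1 - δ) ≤ (Measure.pi fun _ => F) B ∧
      ∀ x ∈ B, ∀ Ω ∈ G, |empMass x Ω - F.real Ω| ≤ penalty F G n δ := by
  set μ := Measure.pi fun _ : Fin n => F
  have hn0 : (0 : ℝ) < n := by exact_mod_cast hn
  have hD := measurable_ghostDeviation hG n
  have hDint : ∀ x : Fin n → E, Integrable (fun y => ghostDeviation G (x, y)) μ := fun x =>
    integrable_of_measurable_of_abs_le (hD.comp measurable_prodMk_left) fun y =>
      abs_ghostDeviation_le G _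
  -- `h` replaces the supremum of `|empMass x Ω - F.real Ω|`: it is measurable, it dominates that
  -- supremum because `F.real Ω` is the mean of the ghost empirical mass, and its mean is at most
  -- twice the Rademacher average.
  set h : (Fin n → E) → ℝ := fun x => ∫ y, ghostDeviation G (x, y) ∂μ with hh
  have hm : Measurable h := hD.stronglyMeasurable.integral_prod_right'.measurable
  have hM : ∀ x, |h x| ≤ 2 := fun x => by
    have := norm_integral_le_of_norm_le_const (μ := μ) (C := 2)
      (f := fun y => ghostDeviation G (x, y))
      (Filter.Eventually.of_forall fun a => abs_ghostDeviation_le G _)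
    simpa using this
  have hd : ∀ x i a, |h (Function.update x i a) - h x| ≤ ((1 / n : NNReal) : ℝ) := fun x i a => by
    have h0 : h (Function.update x i a) - h x
        = ∫ y, (ghostDeviation G (Function.update x i a, y) - ghostDeviation G (x, y)) ∂μ :=
      (integral_sub (hDint _) (hDint _)).symm
    rw [h0]
    have := norm_integral_le_of_norm_le_const (μ := μ) (C := 1 / n)
      (f := fun y => ghostDeviation G (Function.update x i a, y) - ghostDeviation G (x, y))
      (Filter.Eventually.of_forall fun y => ghostDeviation_update_sub_le G x y i a)
    simpa using this
  have hsub := hasSubgaussianMGF_of_boundedDifferences F (1 / n) 2 n h hm hM hd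
  have hmean : ∫ x, h x ∂μ ≤ 2 * rademacherAverage F G n := by
    refine le_trans (le_of_eq ?_) (integral_ghostDeviation_le F hG n)
    rw [integral_prod _ (integrable_of_measurable_of_abs_le hD fun p => abs_ghostDeviation_le G p)]
  set r := Real.sqrt (Real.log (1 / δ) / (2 * n)) with hr
  have hlog : 0 ≤ Real.log (1 / δ) := Real.log_nonneg (by
    rw [le_div_iff₀ hδ.1]; linarith [hδ.2])
  have htail : μ.real {x | r ≤ h x - ∫ y, h y ∂μ} ≤ δ := by
    refine (hsub.measure_ge_le (Real.sqrt_nonneg _)).trans (le_of_eq ?_)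
    rw [Real.sq_sqrt (by positivity)]
    -- The variance proxy is `n (1 / (2n))² = 1 / (4n)`, so the exponent is `-2 n r² = log δ`.
    have : -(Real.log (1 / δ) / (2 * n)) / (2 * ((n * (1 / n / 2) ^ 2 : NNReal) : ℝ))
        = Real.log δ := by
      rw [one_div, Real.log_inv]
      push_cast
      field_simp
    rw [this, Real.exp_log hδ.1]
  have hBc : MeasurableSet {x | r ≤ h x - ∫ y, h y ∂μ} :=
    measurableSet_le measurable_const (hm.sub_const _)
  refine ⟨{x | r ≤ h x - ∫ y, h y ∂μ}ᶜ, hBc.compl, ?_, fun x hx Ω hΩ => ?_⟩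
  · rw [← ofReal_measureReal, probReal_compl_eq_one_sub hBc]
    exact ENNReal.ofReal_le_ofReal (by linarith)
  · have hx' : h x - ∫ y, h y ∂μ < r := by simpa using hx
    have hei : Integrable (fun y : Fin n → E => empMass y Ω) μ := by
      refine integrable_of_measurable_of_abs_le (M := n / n) ?_ fun y => ?_
      · unfold empMass
        refine Measurable.div_const (Finset.measurable_sum _ fun i _ => ?_) _
        exact (measurable_const.indicator (hGm Ω hΩ)).comp (measurable_pi_apply i)
      · rw [empMass, abs_div, abs_of_pos hn0]
        gcongr
        refine (Finset.abs_sum_le_sum_abs _ _).trans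
          ((Finset.sum_le_sum fun i _ => abs_indicator_one_le Ω (y i)).trans ?_)
        simp
    have h1 : empMass x Ω - F.real Ω = ∫ y, (empMass x Ω - empMass y Ω) ∂μ := by
      rw [integral_sub (integrable_const _) hei, integral_empMass F hn (hGm Ω hΩ)]
      simp
    have h2 : |empMass x Ω - F.real Ω| ≤ h x := by
      rw [h1]
      refine (abs_integral_le_integral_abs).trans ?_
      exact integral_mono (((integrable_const _).sub hei).abs) (hDint x) fun y =>
        abs_empMass_sub_le_ghostDeviation x y hΩ
    rw [penalty]
    linarith

end AnomalyRanking

/-! ### Superlevel sets of the density. -/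

namespace AnomalyRanking

variable {E : Type*} [MeasurableSpace E]

/-- `f` is an essentially bounded density of `F` with respect to `vol`, without flat parts. -/
structure IsRegularDensity (vol F : Measure E) (f : E → ℝ) : Prop where
  measurable : Measurable f
  nonneg : ∀ x, 0 ≤ f x
  eq_withDensity : F = vol.withDensity fun x => ENNReal.ofReal (f x)
  no_flat : ∀ t : ℝ, 0 < t → F {x | f x = t} = 0
  bounded : ∃ M : ℝ, ∀ᵐ x ∂vol, f x ≤ M

/-- The superlevel set of `f` of mass `α`. -/
def levelSet (F : Measure E) (f : E → ℝ) (α : ℝ) : Set E := {x | massInv F f α ≤ f x}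

theorem measureReal_eq_diff_add_inter {μ : Measure E} {s t : Set E} (ht : MeasurableSet t)
    (hs : μ s ≠ ⊤) : μ.real s = μ.real (s \ t) + μ.real (s ∩ t) := by
  rw [add_comm]
  exact (measureReal_inter_add_sdiff ht hs).symm

namespace IsRegularDensity

variable {vol F : Measure E} {f : E → ℝ}

theorem measurableSet_levelSet (h : IsRegularDensity vol F f) (α : ℝ) :
    MeasurableSet (levelSet F f α) :=
  measurableSet_le measurable_const h.measurable

theorem ofReal_mul_le (h : IsRegularDensity vol F f) {D : Set E} (hD : MeasurableSet D) {c : ℝ}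
    (hc : ∀ x ∈ D, c ≤ f x) : ENNReal.ofReal c * vol D ≤ F D := by
  rw [h.eq_withDensity, withDensity_apply _ hD, ← setLIntegral_const]
  exact setLIntegral_mono' hD fun x hx => ENNReal.ofReal_le_ofReal (hc x hx)

theorem le_ofReal_mul (h : IsRegularDensity vol F f) {D : Set E} (hD : MeasurableSet D) {c : ℝ}
    (hc : ∀ x ∈ D, f x ≤ c) : F D ≤ ENNReal.ofReal c * vol D := by
  rw [h.eq_withDensity, withDensity_apply _ hD, ← setLIntegral_const]
  exact setLIntegral_mono' hD fun x hx => ENNReal.ofReal_le_ofReal (hc x hx)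

theorem mul_real_le (h : IsRegularDensity vol F f) [IsProbabilityMeasure F] {D : Set E}
    (hD : MeasurableSet D) {c : ℝ} (hc0 : 0 ≤ c) (hc : ∀ x ∈ D, c ≤ f x) :
    c * vol.real D ≤ F.real D := by
  have := ENNReal.toReal_mono (measure_ne_top F D) (h.ofReal_mul_le hD hc)
  rwa [ENNReal.toReal_mul, ENNReal.toReal_ofReal hc0] at this

theorem real_le_mul (h : IsRegularDensity vol F f) {D : Set E} (hD : MeasurableSet D)
    (hDv : vol D ≠ ⊤) {c : ℝ} (hc : ∀ x ∈ D, f x ≤ c) : F.real D ≤ c * vol.real D := by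
  rcases D.eq_empty_or_nonempty with rfl | ⟨x, hx⟩
  · simp
  have hc0 : 0 ≤ c := (h.nonneg x).trans (hc x hx)
  have := ENNReal.toReal_mono (ENNReal.mul_ne_top ENNReal.ofReal_ne_top hDv)
    (h.le_ofReal_mul hD hc)
  rwa [ENNReal.toReal_mul, ENNReal.toReal_ofReal hc0] at this

theorem measure_nonpos (h : IsRegularDensity vol F f) : F {x | f x ≤ 0} = 0 := by
  have := h.le_ofReal_mul (measurableSet_le h.measurable measurable_const) (c := 0)
    (D := {x | f x ≤ 0}) fun x hx => hx
  simpa using this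

theorem exists_measure_ge_eq_zero (h : IsRegularDensity vol F f) : ∃ t, F {x | t ≤ f x} = 0 := by
  obtain ⟨M, hM⟩ := h.bounded
  refine ⟨M + 1, ?_⟩
  have hac : F ≪ vol := by
    rw [h.eq_withDensity]
    exact withDensity_absolutelyContinuous _ _
  refine hac (measure_mono_null (fun x hx => ?_) hM)
  simp only [mem_ofPred_eq] at hx
  simp only [mem_compl_iff, mem_ofPred_eq, not_le]
  linarith

theorem massInv_set_nonempty (h : IsRegularDensity vol F f) {α : ℝ} (hα : 0 ≤ α) :
    {t : ℝ | F.real {x | t ≤ f x} ≤ α}.Nonempty := by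
  obtain ⟨t, ht⟩ := h.exists_measure_ge_eq_zero
  exact ⟨t, by simp [Measure.real, ht, hα]⟩

variable [IsProbabilityMeasure F]

/-- The set `{f ≤ 0}` is `F`-null, so the sets `{f ≥ 1 / (n + 1)}` exhaust the mass. This makes the
infimum in `massInv` a positive number for levels in `[0, 1)`. -/
theorem exists_pos_lt_measure_ge (h : IsRegularDensity vol F f) {α : ℝ} (hα : α < 1) :
    ∃ t, 0 < t ∧ α < F.real {x | t ≤ f x} := by
  have hmono : Monotone fun n : ℕ => {x | 1 / ((n : ℝ) + 1) ≤ f x} := by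
    intro m n hmn x hx
    simp only [mem_ofPred_eq] at hx ⊢
    exact (one_div_le_one_div_of_le (by positivity) (by gcongr)).trans hx
  have hU : (⋃ n : ℕ, {x | 1 / ((n : ℝ) + 1) ≤ f x}) = {x | f x ≤ 0}ᶜ := by
    ext x
    simp only [mem_iUnion, mem_ofPred_eq, mem_compl_iff, not_le]
    constructor
    · rintro ⟨n, hn⟩
      exact lt_of_lt_of_le (by positivity) hn
    · intro hx
      obtain ⟨n, hn⟩ := exists_nat_one_div_lt hx
      exact ⟨n, hn.le⟩
  have ht := tendsto_measure_iUnion_atTop (μ := F) hmono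
  rw [hU, prob_compl_eq_one_sub (measurableSet_le h.measurable measurable_const),
    h.measure_nonpos, tsub_zero] at ht
  have ht' := (ENNReal.tendsto_toReal ENNReal.one_ne_top).comp ht
  obtain ⟨n, hn⟩ := (ht'.eventually (lt_mem_nhds (by simpa using hα))).exists
  exact ⟨1 / ((n : ℝ) + 1), by positivity, hn⟩

theorem bddBelow_massInv_set (h : IsRegularDensity vol F f) {α : ℝ} (hα : α < 1) :
    BddBelow {t : ℝ | F.real {x | t ≤ f x} ≤ α} := by
  obtain ⟨t, -, ht⟩ := h.exists_pos_lt_measure_ge hα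
  refine ⟨t, fun u hu => ?_⟩
  by_contra! hut
  exact absurd (ht.trans_le ((measureReal_mono fun x hx => hut.le.trans hx).trans hu)) (lt_irrefl _)

theorem massInv_pos (h : IsRegularDensity vol F f) {α : ℝ} (hα : α ∈ Ico (0 : ℝ) 1) :
    0 < massInv F f α := by
  obtain ⟨t, ht0, ht⟩ := h.exists_pos_lt_measure_ge hα.2
  refine ht0.trans_le (le_csInf (h.massInv_set_nonempty hα.1) fun u hu => ?_)
  by_contra! hut
  exact absurd (ht.trans_le ((measureReal_mono fun x hx => hut.le.trans hx).trans hu)) (lt_irrefl _)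

theorem massInv_anti (h : IsRegularDensity vol F f) {a b : ℝ} (ha : 0 ≤ a) (hab : a ≤ b)
    (hb : b < 1) : massInv F f b ≤ massInv F f a :=
  csInf_le_csInf (h.bddBelow_massInv_set hb) (h.massInv_set_nonempty ha) fun _ ht => ht.trans hab

theorem levelSet_mono (h : IsRegularDensity vol F f) {a b : ℝ} (ha : 0 ≤ a) (hab : a ≤ b)
    (hb : b < 1) : levelSet F f a ⊆ levelSet F f b :=
  fun _ hx => (h.massInv_anti ha hab hb).trans hx

/-- Upper bound: `{f > q}` is an increasing union of sets of mass at most `α`, and `{f = q}` is null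
because `q > 0`. Lower bound: `{f ≥ q}` is a decreasing intersection of sets of mass larger than
`α`, by minimality of `q`. -/
theorem real_levelSet (h : IsRegularDensity vol F f) {α : ℝ} (hα : α ∈ Ico (0 : ℝ) 1) :
    F.real (levelSet F f α) = α := by
  set q := massInv F f α with hq
  have hne := h.massInv_set_nonempty hα.1
  have hbd := h.bddBelow_massInv_set hα.2
  have hq0 : 0 < q := h.massInv_pos hα
  have hpos : ∀ n : ℕ, (0 : ℝ) < 1 / ((n : ℝ) + 1) := fun n => by positivity
  apply le_antisymm
  · have hle : F.real {x | q < f x} ≤ α := by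
      have hmono : Monotone fun n : ℕ => {x | q + 1 / ((n : ℝ) + 1) ≤ f x} := by
        intro m n hmn x hx
        simp only [mem_ofPred_eq] at hx ⊢
        exact (add_le_add le_rfl
          (one_div_le_one_div_of_le (by positivity) (by gcongr))).trans hx
      have hU : (⋃ n : ℕ, {x | q + 1 / ((n : ℝ) + 1) ≤ f x}) = {x | q < f x} := by
        ext x
        simp only [mem_iUnion, mem_ofPred_eq]
        constructor
        · rintro ⟨n, hn⟩
          linarith [hpos n]
        · intro hx
          obtain ⟨n, hn⟩ := exists_nat_one_div_lt (sub_pos.2 hx)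
          exact ⟨n, by linarith⟩
      have ht := tendsto_measure_iUnion_atTop (μ := F) hmono
      rw [hU] at ht
      have ht' := (ENNReal.tendsto_toReal (measure_ne_top F _)).comp ht
      refine le_of_tendsto' ht' fun n => ?_
      obtain ⟨t, ht, htn⟩ := exists_lt_of_csInf_lt hne (show q < q + 1 / ((n : ℝ) + 1) by
        linarith [hpos n])
      exact (measureReal_mono fun x hx => htn.le.trans hx).trans ht
    have hsub : levelSet F f α ⊆ {x | q < f x} ∪ {x | f x = q} := fun x (hx : q ≤ f x) =>
      hx.lt_or_eq.elim Or.inl fun h => Or.inr h.symm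
    calc F.real (levelSet F f α) ≤ F.real ({x | q < f x} ∪ {x | f x = q}) := measureReal_mono hsub
      _ ≤ F.real {x | q < f x} + F.real {x | f x = q} := measureReal_union_le _ _
      _ ≤ α := by
        have : F.real {x | f x = q} = 0 := by simp [Measure.real, h.no_flat q hq0]
        linarith
  · have hanti : Antitone fun n : ℕ => {x | q - 1 / ((n : ℝ) + 1) ≤ f x} := by
      intro m n hmn x hx
      simp only [mem_ofPred_eq] at hx ⊢
      have : 1 / ((n : ℝ) + 1) ≤ 1 / ((m : ℝ) + 1) :=
        one_div_le_one_div_of_le (by positivity) (by gcongr)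
      linarith
    have hI : (⋂ n : ℕ, {x | q - 1 / ((n : ℝ) + 1) ≤ f x}) = levelSet F f α := by
      ext x
      simp only [mem_iInter, mem_ofPred_eq, levelSet, ← hq]
      constructor
      · intro hx
        by_contra! hlt
        obtain ⟨n, hn⟩ := exists_nat_one_div_lt (sub_pos.2 hlt)
        linarith [hx n]
      · intro hx n
        linarith [hpos n]
    have ht := tendsto_measure_iInter_atTop (μ := F)
      (fun n => (measurableSet_le measurable_const h.measurable).nullMeasurableSet) hanti
      ⟨0, measure_ne_top F _⟩
    rw [hI] at ht
    have ht' := (ENNReal.tendsto_toReal (measure_ne_top F _)).comp ht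
    refine ge_of_tendsto' ht' fun n => ?_
    by_contra! hlt
    have : q ≤ q - 1 / ((n : ℝ) + 1) := csInf_le hbd hlt.le
    linarith [hpos n]

/-- Both infima are over the same set: for `t > 0` the level `{f = t}` is null, and for `t ≤ 0` both
conditions fail since `α < 1`. The tolerance can thus be written with `massInv`. -/
theorem upperQuantile_eq_massInv (h : IsRegularDensity vol F f) {α : ℝ} (hα : α < 1) :
    upperQuantile F f α = massInv F f α := by
  have hc : ∀ t, F.real {x | f x ≤ t} = 1 - F.real {x | t < f x} := fun t => by
    rw [← probReal_compl_eq_one_sub (measurableSet_lt measurable_const h.measurable)]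
    congr 1
    ext x
    simp
  rw [upperQuantile, massInv]
  congr 1
  ext t
  simp only [mem_ofPred_eq]
  rcases le_or_gt t 0 with ht | ht
  · have h1 : F.real {x | f x ≤ t} = 0 := by
      have : F {x | f x ≤ t} = 0 := measure_mono_null (fun x hx => le_trans hx ht) h.measure_nonpos
      simp [Measure.real, this]
    have h2 : {x | t ≤ f x} = univ := eq_univ_of_forall fun x => ht.trans (h.nonneg x)
    rw [h1, h2, probReal_univ]
    constructor <;> intro _ <;> linarith
  · have h1 : F.real {x | t ≤ f x} = F.real {x | t < f x} := by
      have hlt : {x | t < f x} ⊆ {x | t ≤ f x} := fun x (hx : t < f x) => hx.le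
      refine le_antisymm ?_ (measureReal_mono hlt)
      have hsub : {x | t ≤ f x} ⊆ {x | t < f x} ∪ {x | f x = t} := fun x (hx : t ≤ f x) =>
        hx.lt_or_eq.elim Or.inl fun h => Or.inr h.symm
      refine (measureReal_mono hsub).trans ((measureReal_union_le _ _).trans ?_)
      simp [Measure.real, h.no_flat t ht]
    rw [hc, h1]
    constructor <;> intro _ <;> linarith

theorem volume_levelSet_ne_top (h : IsRegularDensity vol F f) {α : ℝ} (hα : α ∈ Ico (0 : ℝ) 1) :
    vol (levelSet F f α) ≠ ⊤ := by
  intro htop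
  have h1 := h.ofReal_mul_le (h.measurableSet_levelSet α) (c := massInv F f α) fun x hx => hx
  rw [htop, ENNReal.mul_top (ENNReal.ofReal_pos.2 (h.massInv_pos hα)).ne'] at h1
  exact absurd (top_le_iff.1 h1) (measure_ne_top F _)

theorem real_levelSet_volume_mono (h : IsRegularDensity vol F f) {a b : ℝ} (ha : 0 ≤ a)
    (hab : a ≤ b) (hb : b < 1) : vol.real (levelSet F f a) ≤ vol.real (levelSet F f b) :=
  measureReal_mono (h.levelSet_mono ha hab hb) (h.volume_levelSet_ne_top ⟨ha.trans hab, hb⟩)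

/-- The optimal curve is Lipschitz away from mass `1`. -/
theorem volume_levelSet_sub_le (h : IsRegularDensity vol F f) {a b c : ℝ} (ha : 0 ≤ a)
    (hab : a ≤ b) (hbc : b ≤ c) (hc : c < 1) :
    vol.real (levelSet F f b) - vol.real (levelSet F f a) ≤ (b - a) / massInv F f c := by
  have hb : b < 1 := hbc.trans_lt hc
  have hsub := h.levelSet_mono ha hab hb
  have hma := h.measurableSet_levelSet a
  have hqc := h.massInv_pos ⟨ha.trans (hab.trans hbc), hc⟩
  -- The shell between the two superlevel sets has mass `b - a`, and there `f` is at least the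
  -- threshold of level `c`.
  have h1 := h.mul_real_le ((h.measurableSet_levelSet b).diff hma) hqc.le
    fun x hx => (h.massInv_anti (ha.trans hab) hbc hc).trans hx.1
  rw [measureReal_sdiff (μ := F) hsub hma, h.real_levelSet ⟨ha.trans hab, hb⟩,
    h.real_levelSet ⟨ha, hab.trans_lt hb⟩] at h1
  rw [measureReal_sdiff hsub hma
    (h.volume_levelSet_ne_top ⟨ha.trans hab, hb⟩)] at h1
  rw [le_div_iff₀ hqc]
  linarith

/-- Superlevel sets of the density have minimum volume. -/
theorem volume_levelSet_le (h : IsRegularDensity vol F f) {α : ℝ} (hα : α ∈ Ico (0 : ℝ) 1)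
    {Ω : Set E} (hΩ : MeasurableSet Ω) (hmass : α ≤ F.real Ω) :
    vol (levelSet F f α) ≤ vol Ω := by
  by_cases hv : vol Ω = ⊤
  · simp [hv]
  have hLv := h.volume_levelSet_ne_top hα
  have hLm := h.measurableSet_levelSet α
  have hq := h.massInv_pos hα
  rw [← ENNReal.toReal_le_toReal hLv hv]
  change vol.real _ ≤ vol.real _
  have e1 := measureReal_eq_diff_add_inter (μ := vol) hΩ hLv
  have e2 := measureReal_eq_diff_add_inter (μ := vol) hLm hv
  have e3 := measureReal_eq_diff_add_inter (μ := F) hΩ (measure_ne_top F (levelSet F f α))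
  have e4 := measureReal_eq_diff_add_inter (μ := F) hLm (measure_ne_top F Ω)
  rw [inter_comm] at e2 e4
  rw [h.real_levelSet hα] at e3
  have i1 := h.mul_real_le (hLm.diff hΩ) hq.le fun x hx => hx.1
  have i2 := h.real_le_mul (hΩ.diff hLm) (measure_ne_top_of_subset sdiff_subset hv)
    (c := massInv F f α) fun x hx => le_of_not_ge hx.2
  -- Neyman–Pearson exchange: `Ω` gains outside the superlevel set at least the mass it gives up
  -- inside, at a density at most `q` against at least `q`, where `q` is the threshold.
  have : massInv F f α * vol.real (levelSet F f α \ Ω)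
      ≤ massInv F f α * vol.real (Ω \ levelSet F f α) := by linarith
  have := le_of_mul_le_mul_left this hq
  linarith

/-- A set which is nearly optimal has a small part outside of the superlevel set. -/
theorem volume_diff_levelSet_le (h : IsRegularDensity vol F f) {α η t : ℝ}
    (hα : α ∈ Ico (0 : ℝ) 1) (ht : 0 < t) {Ω : Set E} (hΩ : MeasurableSet Ω)
    (hvol : vol Ω ≤ vol (levelSet F f α)) (hmass : α - η ≤ F.real Ω)
    (hband : vol {x | |f x - massInv F f α| ≤ t} ≠ ⊤) :
    vol.real (Ω \ levelSet F f α) ≤ vol.real {x | |f x - massInv F f α| ≤ t} + η / t := by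
  set q := massInv F f α with hqd
  set L := levelSet F f α
  have hLv := h.volume_levelSet_ne_top hα
  have hv : vol Ω ≠ ⊤ := ne_top_of_le_ne_top hLv hvol
  have hLm : MeasurableSet L := h.measurableSet_levelSet α
  have hq : 0 < q := h.massInv_pos hα
  have hvr : vol.real Ω ≤ vol.real L := ENNReal.toReal_mono hLv hvol
  -- `Ω \ L` is cut at `f = q - t`. The upper part lies in the band. Each unit of volume of the
  -- lower part loses at least `t` of mass relative to density `q`, while `L \ Ω` has density at
  -- least `q` and at least the volume of `Ω \ L`. As the total loss is at most `η`, the lower part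
  -- has volume at most `η / t`.
  have hB : MeasurableSet {x | f x < q - t} := measurableSet_lt h.measurable measurable_const
  have hdv : vol (Ω \ L) ≠ ⊤ := measure_ne_top_of_subset sdiff_subset hv
  have e1 := measureReal_eq_diff_add_inter (μ := vol) hΩ hLv
  have e2 := measureReal_eq_diff_add_inter (μ := vol) hLm hv
  have e3 := measureReal_eq_diff_add_inter (μ := F) hΩ (measure_ne_top F L)
  have e4 := measureReal_eq_diff_add_inter (μ := F) hLm (measure_ne_top F Ω)
  have e5 := measureReal_eq_diff_add_inter (μ := vol) hB hdv
  have e6 := measureReal_eq_diff_add_inter (μ := F) hB (measure_ne_top F (Ω \ L))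
  rw [inter_comm] at e2 e4
  rw [h.real_levelSet hα] at e3
  have i1 := h.mul_real_le (hLm.diff hΩ) hq.le fun x hx => hx.1
  have i2 := h.real_le_mul ((hΩ.diff hLm).diff hB) (measure_ne_top_of_subset sdiff_subset hdv)
    (c := q) fun x hx => le_of_not_ge hx.1.2
  have i3 := h.real_le_mul ((hΩ.diff hLm).inter hB)
    (measure_ne_top_of_subset inter_subset_left hdv) (c := q - t) fun x hx => le_of_lt hx.2
  have i4 : vol.real ((Ω \ L) \ {x | f x < q - t}) ≤ vol.real {x | |f x - q| ≤ t} := by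
    refine measureReal_mono (fun x hx => ?_) hband
    have h1 : f x < q := lt_of_not_ge hx.1.2
    have h2 : q - t ≤ f x := le_of_not_gt hx.2
    rw [mem_ofPred_eq, abs_le]
    constructor <;> linarith
  have i5 : q * vol.real (Ω \ L) ≤ q * vol.real (L \ Ω) :=
    mul_le_mul_of_nonneg_left (by linarith) hq.le
  rw [e5] at i5
  have i6 : vol.real ((Ω \ L) ∩ {x | f x < q - t}) ≤ η / t := by
    rw [le_div_iff₀ ht]
    linarith
  linarith

end IsRegularDensity

end AnomalyRanking

/-! ### Leaves of the dyadic tree. -/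

namespace AnomalyRanking

theorem dyadicLevel_succ_two_mul (ε : ℝ) (j k : ℕ) :
    dyadicLevel ε (j + 1) (2 * k) = dyadicLevel ε j k := by
  simp only [dyadicLevel, pow_succ]
  push_cast
  field_simp

theorem dyadicLevel_succ_sub (ε : ℝ) (j k : ℕ) :
    dyadicLevel ε j (k + 1) - dyadicLevel ε j k = (1 - ε) / 2 ^ j := by
  simp only [dyadicLevel]
  push_cast
  ring

theorem dyadicLevel_mem_Icc {ε : ℝ} (hε : ε ≤ 1) {j k : ℕ} (hk : k ≤ 2 ^ j) :
    dyadicLevel ε j k ∈ Icc (0 : ℝ) (1 - ε) := by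
  have hε' : 0 ≤ 1 - ε := by linarith
  have hk' : (k : ℝ) ≤ 2 ^ j := by exact_mod_cast hk
  refine ⟨by unfold dyadicLevel; positivity, ?_⟩
  rw [dyadicLevel, div_le_iff₀ (by positivity), mul_comm]
  gcongr

/-- Glues the chains of the two halves of a split interval at their common endpoint `b`. The default
`a` of `getLastD` accounts for an empty first list. -/
theorem isChain_cons_append {R : ℝ → ℝ → Prop} {b : ℝ} {l₂ : List ℝ} (h₂ : (b :: l₂).IsChain R) :
    ∀ {l₁ : List ℝ} {a : ℝ}, (a :: l₁).IsChain R → l₁.getLastD a = b →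
      (a :: (l₁ ++ l₂)).IsChain R
  | [], a, _, h => by
    have : a = b := h
    simpa [this] using h₂
  | c :: l₁, a, h₁, h => by
    rw [List.isChain_cons_cons] at h₁
    rw [List.cons_append, List.isChain_cons_cons]
    exact ⟨h₁.1, isChain_cons_append h₂ h₁.2 (by rwa [List.getLastD_cons] at h)⟩

theorem getLastD_append_getLastD {l₂ : List ℝ} :
    ∀ {l₁ : List ℝ} {a : ℝ}, (l₁ ++ l₂).getLastD a = l₂.getLastD (l₁.getLastD a)
  | [], a => by simp
  | c :: l₁, a => by
    simp only [List.cons_append, List.getLastD_cons]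
    exact getLastD_append_getLastD

/-- The right endpoints of the leaves grown from a node form a chain from its left endpoint to its
right endpoint, along which every relation satisfied by the endpoints of leaves holds. -/
theorem isChain_adaptiveLeaves {split : ℕ → ℕ → Prop} {ε : ℝ} {J : ℕ} {R : ℝ → ℝ → Prop}
    (hR : ∀ j k, k + 1 ≤ 2 ^ j → (¬ split j k ∨ j = J) →
      R (dyadicLevel ε j k) (dyadicLevel ε j (k + 1))) :
    ∀ m j k, m + j = J → k + 1 ≤ 2 ^ j →
      (dyadicLevel ε j k :: (adaptiveLeaves split m j k).map
        fun p => dyadicLevel ε p.1 (p.2 + 1)).IsChain R ∧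
      ((adaptiveLeaves split m j k).map fun p => dyadicLevel ε p.1 (p.2 + 1)).getLastD
        (dyadicLevel ε j k) = dyadicLevel ε j (k + 1) := by
  intro m
  induction m with
  | zero =>
    intro j k hj hk
    simpa [adaptiveLeaves] using hR j k hk (Or.inr (by omega))
  | succ m ih =>
    intro j k hj hk
    by_cases hs : split j k
    · have hp : 2 ^ (j + 1) = 2 * 2 ^ j := by ring
      obtain ⟨c₁, e₁⟩ := ih (j + 1) (2 * k) (by omega) (by omega)
      obtain ⟨c₂, e₂⟩ := ih (j + 1) (2 * k + 1) (by omega) (by omega)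
      have hr : dyadicLevel ε (j + 1) (2 * k + 1 + 1) = dyadicLevel ε j (k + 1) :=
        dyadicLevel_succ_two_mul ε j (k + 1)
      rw [dyadicLevel_succ_two_mul] at c₁ e₁
      rw [hr] at e₂
      simp only [adaptiveLeaves, if_pos hs, List.map_append]
      refine ⟨isChain_cons_append c₂ c₁ e₁, ?_⟩
      rw [getLastD_append_getLastD, e₁, e₂]
    · simpa [adaptiveLeaves, hs] using hR j k hk (Or.inl hs)

/-- Only the depth of split nodes matters. Below a split node `2 ^ j ≤ B`, so the maximum at each
child is `2 * B`; a child carries the factor `2 ^ (j + 1)`, and the two bounds add up to `2 * B`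
again. At the root this counts the leaves. -/
theorem two_pow_mul_length_adaptiveLeaves_le {split : ℕ → ℕ → Prop} {B : ℝ}
    (hB : ∀ j k, k + 1 ≤ 2 ^ j → split j k → (2 : ℝ) ^ j ≤ B) :
    ∀ m j k, k + 1 ≤ 2 ^ j →
      (2 : ℝ) ^ j * (adaptiveLeaves split m j k).length ≤ max (2 ^ j) (2 * B) := by
  intro m
  induction m with
  | zero =>
    intro j k _
    simp [adaptiveLeaves]
  | succ m ih =>
    intro j k hk
    by_cases hs : split j k
    · have hp : 2 ^ (j + 1) = 2 * 2 ^ j := by ring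
      have h₁ := ih (j + 1) (2 * k) (by omega)
      have h₂ := ih (j + 1) (2 * k + 1) (by omega)
      have hj := hB j k hk hs
      have hp' : (2 : ℝ) ^ (j + 1) = 2 * 2 ^ j := by ring
      rw [max_eq_right (by linarith), hp'] at h₁ h₂
      refine le_max_of_le_right ?_
      simp only [adaptiveLeaves, if_pos hs, List.length_append]
      push_cast
      linarith
    · simp [adaptiveLeaves, hs]

/-! ### Overlaid sets and the score they define. -/

variable {E : Type*}

theorem monotone_monotoneSets (S : ℕ → Set E) : Monotone (monotoneSets S) :=
  monotone_nat_of_le_succ fun _ => subset_union_right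

theorem subset_monotoneSets (S : ℕ → Set E) : ∀ k, S k ⊆ monotoneSets S k
  | 0 => Subset.rfl
  | _ + 1 => subset_union_left

/-- A point of `S j` either lies in `L j`, hence in `L K`, or in the excess `S j \ L j`. The union
thus costs only the sum of the excesses. -/
theorem monotoneSets_subset {S L : ℕ → Set E} :
    ∀ {K : ℕ}, (∀ k < K, L k ⊆ L (k + 1)) →
      monotoneSets S K ⊆ L K ∪ ⋃ j ∈ Finset.range (K + 1), S j \ L j
  | 0, _ => fun x hx => by
    by_cases hxL : x ∈ L 0
    · exact Or.inl hxL
    · exact Or.inr (mem_biUnion (x := 0) (by simp) ⟨hx, hxL⟩)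
  | K + 1, hL => fun x hx => by
    by_cases hxL : x ∈ L (K + 1)
    · exact Or.inl hxL
    refine Or.inr ?_
    rcases hx with hx | hx
    · exact mem_biUnion (x := K + 1) (by simp) ⟨hx, hxL⟩
    · rcases monotoneSets_subset (fun k hk => hL k (by omega)) hx with h | h
      · exact absurd (hL K (by omega) h) hxL
      · obtain ⟨j, hj, hxj⟩ := mem_iUnion₂.1 h
        refine mem_biUnion (x := j) ?_ hxj
        simp only [Finset.coe_range, mem_Iio, Finset.mem_range] at hj ⊢
        omega

theorem overlayScore_of_notMem {T : ℕ → Set E} (hT : Monotone T) {K : ℕ} {x : E} (hx : x ∉ T K) :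
    overlayScore T K x = 0 := by
  refine Finset.sum_eq_zero fun k hk => ?_
  have hk' : k ≤ K := Nat.lt_succ_iff.1 (Finset.mem_range.1 hk)
  have : x ∉ layer T k := by
    intro h
    cases k with
    | zero => exact hx (hT hk' h)
    | succ k => exact hx (hT hk' h.1)
  simp [this]

/-- The layers are disjoint: only that of the first set containing `x` contributes. -/
theorem overlayScore_of_isLeast {T : ℕ → Set E} (hT : Monotone T) {K j : ℕ} (hj : j ≤ K) {x : E}
    (hx : x ∈ T j) (hmin : ∀ i < j, x ∉ T i) : overlayScore T K x = (K : ℝ) - j + 1 := by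
  rw [overlayScore, Finset.sum_eq_single j]
  · have : x ∈ layer T j := by
      cases j with
      | zero => exact hx
      | succ j => exact ⟨hx, hmin j (by omega)⟩
    simp [this]
  · intro k _ hk
    have : x ∉ layer T k := by
      intro h
      rcases lt_or_gt_of_ne hk with hlt | hgt
      · cases k with
        | zero => exact hmin 0 hlt h
        | succ k => exact hmin (k + 1) hlt h.1
      · cases k with
        | zero => omega
        | succ k => exact h.2 (hT (by omega) hx)
    simp [this]
  · intro h
    exact absurd (Finset.mem_range.2 (by omega)) h

open Classical in
theorem overlayScore_cases {T : ℕ → Set E} (hT : Monotone T) (K : ℕ) (x : E) :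
    (x ∉ T K ∧ overlayScore T K x = 0) ∨
      ∃ j ≤ K, x ∈ T j ∧ (∀ i < j, x ∉ T i) ∧ overlayScore T K x = (K : ℝ) - j + 1 := by
  by_cases hx : x ∈ T K
  · have h : ∃ j, x ∈ T j := ⟨K, hx⟩
    have hle : Nat.find h ≤ K := Nat.find_min' h hx
    exact Or.inr ⟨Nat.find h, hle, Nat.find_spec h, fun i hi => Nat.find_min h hi,
      overlayScore_of_isLeast hT hle (Nat.find_spec h) fun i hi => Nat.find_min h hi⟩
  · exact Or.inl ⟨hx, overlayScore_of_notMem hT hx⟩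

theorem overlayScore_pos_iff {T : ℕ → Set E} (hT : Monotone T) (K : ℕ) (x : E) :
    0 < overlayScore T K x ↔ x ∈ T K := by
  rcases overlayScore_cases hT K x with ⟨hx, h⟩ | ⟨j, hj, hx, -, h⟩
  · simp [h, hx]
  · have : (j : ℝ) ≤ K := by exact_mod_cast hj
    exact ⟨fun _ => hT hj hx, fun _ => by rw [h]; linarith⟩

theorem le_overlayScore_iff {T : ℕ → Set E} (hT : Monotone T) {K k : ℕ} (hk : k ≤ K) (x : E) :
    (K : ℝ) - k + 1 ≤ overlayScore T K x ↔ x ∈ T k := by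
  have hk' : (k : ℝ) ≤ K := by exact_mod_cast hk
  rcases overlayScore_cases hT K x with ⟨hx, h⟩ | ⟨j, hj, hx, hmin, h⟩
  · rw [h]
    refine ⟨fun h => by linarith, fun h => absurd (hT hk h) hx⟩
  · rw [h]
    constructor
    · intro hle
      have : (j : ℝ) ≤ k := by linarith
      exact hT (by exact_mod_cast this) hx
    · intro hxk
      have : j ≤ k := by
        by_contra! hlt
        exact hmin k hlt hxk
      have : (j : ℝ) ≤ k := by exact_mod_cast this
      linarith

theorem setOf_le_overlayScore_subset {T : ℕ → Set E} (hT : Monotone T) {K k : ℕ} {t : ℝ}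
    (hkK : k ≤ K) (ht : (K : ℝ) - k + 1 < t) :
    {x | t ≤ overlayScore T K x} ⊆ {x | ∃ i < k, x ∈ T i} := by
  intro x hx
  rw [mem_ofPred_eq] at hx
  have hk' : (k : ℝ) ≤ K := by exact_mod_cast hkK
  rcases overlayScore_cases hT K x with ⟨-, h⟩ | ⟨j, hj, hxj, hmin, h⟩
  · rw [h] at hx
    linarith
  · rw [h] at hx
    have : (j : ℝ) < k := by linarith
    exact ⟨j, by exact_mod_cast this, hxj⟩

variable [MeasurableSpace E]

/-- The mass volume curve of an overlay score at `α` is the volume of the first overlaid set of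
mass larger than `α`. -/
theorem massVolume_overlayScore (vol F : Measure E) [IsProbabilityMeasure F] {T : ℕ → Set E}
    (hT : Monotone T) {K k : ℕ} (hk : k ≤ K) {α : ℝ} (hα : 0 ≤ α) (hlt : α < F.real (T k))
    (hle : ∀ i < k, F.real (T i) ≤ α) :
    massVolume vol F (overlayScore T K) α = vol (T k) := by
  -- The half-line is open, so its infimum has a superlevel set, `T k`, of mass larger than `α`.
  have hset : {t : ℝ | F.real {x | t ≤ overlayScore T K x} ≤ α} = Ioi ((K : ℝ) - k + 1) := by
    ext t
    rw [mem_ofPred_eq, mem_Ioi]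
    constructor
    · intro h
      by_contra! ht
      refine absurd (hlt.trans_le ((measureReal_mono fun x hx => ?_).trans h)) (lt_irrefl _)
      exact ht.trans ((le_overlayScore_iff hT hk x).2 hx)
    · intro ht
      have hsub := setOf_le_overlayScore_subset hT hk ht
      cases k with
      | zero =>
        have : {x | t ≤ overlayScore T K x} = ∅ := by
          refine subset_empty_iff.1 (hsub.trans ?_)
          rintro x ⟨i, hi, -⟩
          omega
        rw [this]
        simpa using hα
      | succ k =>
        refine (measureReal_mono (hsub.trans ?_)).trans (hle k (by omega))
        rintro x ⟨i, hi, hx⟩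
        exact hT (by omega) hx
  rw [massVolume, massInv, hset, csInf_Ioi]
  congr 1
  ext x
  exact le_overlayScore_iff hT hk x

end AnomalyRanking

/-! ### Deterministic analysis of A-Rank on a nearly optimal family. -/

namespace AnomalyRanking

variable {E : Type*} [MeasurableSpace E]

/-- `Ωhat α` has at most the minimum volume at mass `α`, up to a loss `η` of mass, for every level
`α ≤ β`. -/
structure IsNearOptimalFamily (vol F : Measure E) (f : E → ℝ) (β η : ℝ) (Ωhat : ℝ → Set E) :
    Prop where
  measurable : ∀ α ∈ Icc 0 β, MeasurableSet (Ωhat α)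
  volume_le : ∀ α ∈ Icc 0 β, vol (Ωhat α) ≤ vol (levelSet F f α)
  le_mass : ∀ α ∈ Icc 0 β, α - η ≤ F.real (Ωhat α)

/-- The adaptive breakpoints increase from `0` to `1 - ε`. -/
theorem adaptiveBreakpoints_spec (vol : Measure E) (Ωhat : ℝ → Set E) (ε τ : ℝ) (n : ℕ)
    {R : ℝ → ℝ → Prop}
    (hR : ∀ j k, k + 1 ≤ 2 ^ j → (empLocalError vol Ωhat ε j k ≤ τ ∨ j = Nat.log 2 n + 1) →
      R (dyadicLevel ε j k) (dyadicLevel ε j (k + 1))) :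
    (adaptiveBreakpoints vol Ωhat ε τ n).getD 0 0 = 0 ∧
      (adaptiveBreakpoints vol Ωhat ε τ n).getD
        ((adaptiveBreakpoints vol Ωhat ε τ n).length - 1) 0 = 1 - ε ∧
      ∀ k < (adaptiveBreakpoints vol Ωhat ε τ n).length - 1,
        R ((adaptiveBreakpoints vol Ωhat ε τ n).getD k 0)
          ((adaptiveBreakpoints vol Ωhat ε τ n).getD (k + 1) 0) := by
  obtain ⟨hc, hl⟩ := isChain_adaptiveLeaves
    (split := fun j k => τ < empLocalError vol Ωhat ε j k) (ε := ε) (J := Nat.log 2 n + 1) (R := R)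
    (fun j k hk h => hR j k hk (h.imp not_lt.1 id)) (Nat.log 2 n + 1) 0 0 rfl (by simp)
  have h0 : dyadicLevel ε 0 0 = 0 := by simp [dyadicLevel]
  have h1 : dyadicLevel ε 0 (0 + 1) = 1 - ε := by simp [dyadicLevel]
  rw [h0] at hc hl
  rw [h1] at hl
  set l := (adaptiveLeaves (fun j k => τ < empLocalError vol Ωhat ε j k) (Nat.log 2 n + 1) 0 0).map
    fun p => dyadicLevel ε p.1 (p.2 + 1)
  have hb : adaptiveBreakpoints vol Ωhat ε τ n = 0 :: l := rfl
  rw [hb]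
  refine ⟨rfl, ?_, fun k hk => ?_⟩
  · rw [← hl]
    simp [List.getD_eq_getElem?_getD, List.getLast?_eq_getElem?]
    cases l <;> simp
  · simp only [List.length_cons, Nat.add_sub_cancel] at hk
    rw [List.getD_eq_getElem _ _ (by simp; omega), List.getD_eq_getElem _ _ (by simp; omega)]
    exact List.isChain_iff_getElem.1 hc k (by simp; omega)

theorem length_adaptiveBreakpoints_le (vol : Measure E) (Ωhat : ℝ → Set E) (ε τ : ℝ) (n : ℕ)
    {B : ℝ} (hB : ∀ j k, k + 1 ≤ 2 ^ j → τ < empLocalError vol Ωhat ε j k → (2 : ℝ) ^ j ≤ B) :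
    (((adaptiveBreakpoints vol Ωhat ε τ n).length - 1 : ℕ) : ℝ) ≤ max 1 (2 * B) := by
  have := two_pow_mul_length_adaptiveLeaves_le
    (split := fun j k => τ < empLocalError vol Ωhat ε j k) hB (Nat.log 2 n + 1) 0 0 (by simp)
  simpa [adaptiveBreakpoints] using this

namespace IsNearOptimalFamily

variable {vol F : Measure E} {f : E → ℝ} {ε φ : ℝ} {Ωhat : ℝ → Set E} [IsProbabilityMeasure F]

theorem real_volume_le (hN : IsNearOptimalFamily vol F f (1 - ε) (2 * φ) Ωhat)
    (h : IsRegularDensity vol F f) (hε : 0 < ε) {α : ℝ} (hα : α ∈ Icc 0 (1 - ε)) :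
    vol.real (Ωhat α) ≤ vol.real (levelSet F f α) :=
  ENNReal.toReal_mono (h.volume_levelSet_ne_top ⟨hα.1, by linarith [hα.2]⟩) (hN.volume_le α hα)

/-- `Ωhat α` has mass at least `max (α - 2φ) 0`, hence at least the minimum volume at that level;
the Lipschitz bound brings the level back to `α`. -/
theorem le_real_volume (hN : IsNearOptimalFamily vol F f (1 - ε) (2 * φ) Ωhat)
    (h : IsRegularDensity vol F f) (hε : 0 < ε) (hφ : 0 ≤ φ) {α : ℝ} (hα : α ∈ Icc 0 (1 - ε)) :
    vol.real (levelSet F f α) - 2 * φ / massInv F f (1 - ε) ≤ vol.real (Ωhat α) := by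
  have hα1 : α < 1 := by linarith [hα.2]
  set a := max (α - 2 * φ) 0
  have ha : a ≤ α := max_le (by linarith) hα.1
  have ha0 : 0 ≤ a := le_max_right _ _
  have hv : vol (Ωhat α) ≠ ⊤ :=
    ne_top_of_le_ne_top (h.volume_levelSet_ne_top ⟨hα.1, hα1⟩) (hN.volume_le α hα)
  have h1 : vol.real (levelSet F f a) ≤ vol.real (Ωhat α) :=
    ENNReal.toReal_mono hv (h.volume_levelSet_le ⟨ha0, by linarith⟩ (hN.measurable α hα)
      (max_le (hN.le_mass α hα) measureReal_nonneg))
  have h2 := h.volume_levelSet_sub_le ha0 ha hα.2 (by linarith)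
  have hQ := h.massInv_pos (α := 1 - ε) ⟨hα.1.trans hα.2, by linarith⟩
  have h3 : (α - a) / massInv F f (1 - ε) ≤ 2 * φ / massInv F f (1 - ε) := by
    gcongr
    linarith [le_max_left (α - 2 * φ) 0]
  linarith

/-- An interval which is split is long. -/
theorem two_pow_le_of_split (hN : IsNearOptimalFamily vol F f (1 - ε) (2 * φ) Ωhat)
    (h : IsRegularDensity vol F f) (hε : 0 < ε) (hε1 : ε < 1) (hφ : 0 ≤ φ) {r : ℝ} (hr : 0 < r)
    {j k : ℕ} (hk : k + 1 ≤ 2 ^ j)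
    (hs : 4 * φ / massInv F f (1 - ε) + r < empLocalError vol Ωhat ε j k) :
    (2 : ℝ) ^ j ≤ 1 / (massInv F f (1 - ε) * r) := by
  have hQ := h.massInv_pos (α := 1 - ε) ⟨by linarith, by linarith⟩
  have ha := dyadicLevel_mem_Icc hε1.le (show k ≤ 2 ^ j by omega)
  have hb := dyadicLevel_mem_Icc hε1.le hk
  have hlen := dyadicLevel_succ_sub ε j k
  have hlen0 : 0 ≤ (1 - ε) / 2 ^ j := div_nonneg (by linarith) (by positivity)
  have h1 := hN.real_volume_le h hε hb
  have h2 := hN.le_real_volume h hε hφ ha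
  have h3 := h.volume_levelSet_sub_le ha.1 (by linarith) hb.2 (by linarith)
  rw [hlen] at h3
  rw [empLocalError] at hs
  -- The estimated increment exceeds the true one by at most `2φ / Q`, which the term `4φ / Q` of
  -- the tolerance absorbs: the true increment is larger than `r`.
  have h4 : 2 * φ / massInv F f (1 - ε) ≤ 4 * φ / massInv F f (1 - ε) := by gcongr; norm_num
  have h5 : r < (1 - ε) / 2 ^ j / massInv F f (1 - ε) := by linarith
  rw [div_div, lt_div_iff₀ (by positivity)] at h5
  rw [le_div_iff₀ (by positivity)]
  linarith

/-- On an interval which is not split, the optimal curve varies little. -/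
theorem volume_levelSet_sub_le_of_leaf (hN : IsNearOptimalFamily vol F f (1 - ε) (2 * φ) Ωhat)
    (h : IsRegularDensity vol F f) (hε : 0 < ε) (hε1 : ε < 1) (hφ : 0 ≤ φ) {r : ℝ} (hr : 0 < r)
    {n : ℕ} (hn : 1 ≤ n) {j k : ℕ} (hk : k + 1 ≤ 2 ^ j)
    (hs : empLocalError vol Ωhat ε j k ≤ 4 * φ / massInv F f (1 - ε) + r ∨
      j = Nat.log 2 n + 1) :
    vol.real (levelSet F f (dyadicLevel ε j (k + 1))) - vol.real (levelSet F f (dyadicLevel ε j k))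
      ≤ 6 * φ / massInv F f (1 - ε) + r + 1 / (n * massInv F f (1 - ε)) := by
  have hQ := h.massInv_pos (α := 1 - ε) ⟨by linarith, by linarith⟩
  have ha := dyadicLevel_mem_Icc hε1.le (show k ≤ 2 ^ j by omega)
  have hb := dyadicLevel_mem_Icc hε1.le hk
  have hlen := dyadicLevel_succ_sub ε j k
  have hlen0 : 0 ≤ (1 - ε) / 2 ^ j := div_nonneg (by linarith) (by positivity)
  have hn0 : (0 : ℝ) < n := by exact_mod_cast hn
  rcases hs with hs | rfl
  · have h1 := hN.real_volume_le h hε ha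
    have h2 := hN.le_real_volume h hε hφ hb
    rw [empLocalError] at hs
    have h3 : 6 * φ / massInv F f (1 - ε)
        = 4 * φ / massInv F f (1 - ε) + 2 * φ / massInv F f (1 - ε) := by ring
    have h4 : 0 ≤ 1 / (n * massInv F f (1 - ε)) := by positivity
    linarith
  · have h3 := h.volume_levelSet_sub_le ha.1 (by linarith) hb.2 (by linarith)
    rw [hlen] at h3
    -- At maximal depth the interval is no longer than `1 / n`, and the Lipschitz bound suffices.
    have hpow : (n : ℝ) ≤ 2 ^ (Nat.log 2 n + 1) := by
      exact_mod_cast (Nat.lt_pow_succ_log_self (by norm_num) n).le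
    have h4 : (1 - ε) / 2 ^ (Nat.log 2 n + 1) ≤ 1 / n :=
      div_le_div₀ (by norm_num) (by linarith) hn0 hpow
    have h5 : (1 - ε) / 2 ^ (Nat.log 2 n + 1) / massInv F f (1 - ε)
        ≤ 1 / (n * massInv F f (1 - ε)) := by
      rw [← div_div]
      gcongr
    have h6 : 0 ≤ 6 * φ / massInv F f (1 - ε) := by positivity
    linarith

/-- Performance of the A-Rank score built from a near optimal family, in terms of a bound `e` on
the volume that its members have outside of the corresponding superlevel sets. -/
theorem aRankScore_bounds (hN : IsNearOptimalFamily vol F f (1 - ε) (2 * φ) Ωhat)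
    (h : IsRegularDensity vol F f) (hε : 0 < ε) (hε1 : ε < 1) (hφ : 0 ≤ φ) {r e : ℝ} (hr : 0 < r)
    {n : ℕ} (hn : 1 ≤ n)
    (he : ∀ α ∈ Icc 0 (1 - ε), vol.real (Ωhat α \ levelSet F f α) ≤ e)
    {Q : ℝ} (hQdef : Q = massInv F f (1 - ε)) {s : E → ℝ}
    (hs : s = aRankScore vol Ωhat ε (4 * φ / Q + r) n) {C : ℝ}
    (hC : 8 * φ / Q + r + 1 / (n * Q) + (2 + 2 / (Q * r)) * e ≤ C) :
    1 - ε - 2 * φ ≤ F.real {x | 0 < s x} ∧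
    (∀ α ∈ Icc (0 : ℝ) (1 - ε), α < F.real {x | 0 < s x} →
      massVolume vol F s α ≤ massVolume vol F f α + ENNReal.ofReal C) ∧
    (∀ α ∈ Icc (0 : ℝ) (1 - ε), F.real {x | 0 < s x} ≤ α →
      vol {x | 0 < s x} ≤ massVolume vol F f α + ENNReal.ofReal C) := by
  have hQ : 0 < Q := hQdef ▸ h.massInv_pos (α := 1 - ε) ⟨by linarith, by linarith⟩
  have hn0 : (0 : ℝ) < n := by exact_mod_cast hn
  have hβ : (0 : ℝ) ∈ Icc 0 (1 - ε) := ⟨le_rfl, by linarith⟩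
  have he0 : 0 ≤ e := measureReal_nonneg.trans (he 0 hβ)
  set Δ := 6 * φ / Q + r + 1 / (n * Q) with hΔ
  have hΔ0 : 0 ≤ Δ := by positivity
  -- The relation carried along the breakpoints holds both their order and the variation of the
  -- optimal curve on a leaf.
  obtain ⟨b0, bK, bR⟩ := adaptiveBreakpoints_spec vol Ωhat ε (4 * φ / Q + r) n
    (R := fun a b => a ≤ b ∧ vol.real (levelSet F f b) - vol.real (levelSet F f a) ≤ Δ)
    (fun j k hk hjk => by
      rw [hQdef] at hjk
      refine ⟨?_, (hN.volume_levelSet_sub_le_of_leaf h hε hε1 hφ hr hn hk hjk).trans_eq ?_⟩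
      · have hlen := dyadicLevel_succ_sub ε j k
        have hlen0 : 0 ≤ (1 - ε) / 2 ^ j := div_nonneg (by linarith) (by positivity)
        linarith
      · rw [hΔ, hQdef])
  have hK := length_adaptiveBreakpoints_le vol Ωhat ε (4 * φ / Q + r) n (B := 1 / (Q * r))
    fun j k hk hjk => by
      rw [hQdef] at hjk ⊢
      exact hN.two_pow_le_of_split h hε hε1 hφ hr hk hjk
  rw [aRankScore] at hs
  set K := (adaptiveBreakpoints vol Ωhat ε (4 * φ / Q + r) n).length - 1
  set a : ℕ → ℝ := fun k => (adaptiveBreakpoints vol Ωhat ε (4 * φ / Q + r) n).getD k 0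
  set T := monotoneSets fun k => Ωhat (a k)
  change a 0 = 0 at b0
  change a K = 1 - ε at bK
  change ∀ k < K, a k ≤ a (k + 1) ∧
    vol.real (levelSet F f (a (k + 1))) - vol.real (levelSet F f (a k)) ≤ Δ at bR
  change s = overlayScore T K at hs
  have hamono : ∀ {i k}, i ≤ k → k ≤ K → a i ≤ a k := by
    intro i k hik
    induction k, hik using Nat.le_induction with
    | base => exact fun _ => le_rfl
    | succ k _ ih => exact fun hk => (ih (by omega)).trans (bR k (by omega)).1
  have ha : ∀ {k}, k ≤ K → a k ∈ Icc 0 (1 - ε) := fun {k} hk =>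
    ⟨b0 ▸ hamono (Nat.zero_le k) hk, bK ▸ hamono hk le_rfl⟩
  have hT : Monotone T := monotone_monotoneSets _
  have hKe : ((K : ℝ) + 1) * e ≤ (2 + 2 / (Q * r)) * e := by
    refine mul_le_mul_of_nonneg_right ?_ he0
    have h1 : 0 ≤ 2 * (1 / (Q * r)) := by positivity
    have h2 : max 1 (2 * (1 / (Q * r))) ≤ 1 + 2 * (1 / (Q * r)) := max_le (by linarith) (by linarith)
    have h3 : 2 / (Q * r) = 2 * (1 / (Q * r)) := by ring
    rw [h3]
    linarith
  -- It suffices to compare superlevel sets up to `Δ + 2φ / Q`, which accounts for `8 = 6 + 2` in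
  -- `hC`; the excesses add `(K + 1) e`.
  have hTvol : ∀ k ≤ K, ∀ α ∈ Icc (0 : ℝ) (1 - ε),
      vol.real (levelSet F f (a k)) ≤ vol.real (levelSet F f α) + (Δ + 2 * φ / Q) →
      vol (T k) ≤ massVolume vol F f α + ENNReal.ofReal C := by
    intro k hk α hα hle
    have hfin : ∀ {b}, b ∈ Icc 0 (1 - ε) → vol (levelSet F f b) ≠ ⊤ := fun hb =>
      h.volume_levelSet_ne_top ⟨hb.1, by linarith [hb.2]⟩
    have hsub : T k ⊆ levelSet F f (a k) ∪
        ⋃ j ∈ Finset.range (k + 1), Ωhat (a j) \ levelSet F f (a j) :=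
      monotoneSets_subset (S := fun k => Ωhat (a k)) (L := fun k => levelSet F f (a k))
        fun i hi => h.levelSet_mono (ha (by omega)).1 (bR i (by omega)).1
          (by linarith [(ha (k := i + 1) (by omega)).2])
    have hsum : vol (⋃ j ∈ Finset.range (k + 1), Ωhat (a j) \ levelSet F f (a j))
        ≤ ENNReal.ofReal (((K : ℝ) + 1) * e) := by
      refine (measure_biUnion_finset_le _ _).trans ?_
      calc ∑ j ∈ Finset.range (k + 1), vol (Ωhat (a j) \ levelSet F f (a j))
          ≤ ∑ _j ∈ Finset.range (k + 1), ENNReal.ofReal e := by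
            refine Finset.sum_le_sum fun j hj => ?_
            have hj' := ha (k := j) (by have := Finset.mem_range.1 hj; omega)
            have hne : vol (Ωhat (a j) \ levelSet F f (a j)) ≠ ⊤ :=
              measure_ne_top_of_subset sdiff_subset
                (ne_top_of_le_ne_top (hfin hj') (hN.volume_le _ hj'))
            rw [← ofReal_measureReal hne]
            exact ENNReal.ofReal_le_ofReal (he _ hj')
        _ = ENNReal.ofReal (((k + 1 : ℕ) : ℝ) * e) := by
            rw [Finset.sum_const, Finset.card_range, nsmul_eq_mul,
              ENNReal.ofReal_mul (by positivity), ENNReal.ofReal_natCast]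
        _ ≤ ENNReal.ofReal (((K : ℝ) + 1) * e) := by
            refine ENNReal.ofReal_le_ofReal (mul_le_mul_of_nonneg_right ?_ he0)
            exact_mod_cast Nat.succ_le_succ hk
    have hlev : vol (levelSet F f (a k)) ≤ vol (levelSet F f α) + ENNReal.ofReal (Δ + 2 * φ / Q) := by
      rw [← ofReal_measureReal (hfin (ha hk)), ← ofReal_measureReal (hfin hα),
        ← ENNReal.ofReal_add measureReal_nonneg (by positivity)]
      exact ENNReal.ofReal_le_ofReal hle
    calc vol (T k) ≤ vol (levelSet F f (a k))
          + vol (⋃ j ∈ Finset.range (k + 1), Ωhat (a j) \ levelSet F f (a j)) :=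
          (measure_mono hsub).trans (measure_union_le _ _)
      _ ≤ vol (levelSet F f α) + ENNReal.ofReal (Δ + 2 * φ / Q)
          + ENNReal.ofReal (((K : ℝ) + 1) * e) := add_le_add hlev hsum
      _ = vol (levelSet F f α) + ENNReal.ofReal (Δ + 2 * φ / Q + ((K : ℝ) + 1) * e) := by
          rw [add_assoc, ← ENNReal.ofReal_add (by positivity) (by positivity)]
      _ ≤ massVolume vol F f α + ENNReal.ofReal C := by
          refine add_le_add le_rfl (ENNReal.ofReal_le_ofReal (le_trans ?_ hC))
          have : 8 * φ / Q = 6 * φ / Q + 2 * φ / Q := by ring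
          rw [this]
          linarith
  have hTmass : ∀ k ≤ K, a k - 2 * φ ≤ F.real (T k) := fun k hk =>
    (hN.le_mass _ (ha hk)).trans
      (measureReal_mono (subset_monotoneSets (fun k => Ωhat (a k)) k))
  -- A mass of `T k` at most `α` forces `a k ≤ α + 2φ`.
  have hcompare : ∀ k ≤ K, ∀ α ∈ Icc (0 : ℝ) (1 - ε), F.real (T k) ≤ α →
      vol.real (levelSet F f (a k)) ≤ vol.real (levelSet F f α) + 2 * φ / Q := by
    intro k hk α hα hle
    have hφQ : 0 ≤ 2 * φ / Q := by positivity
    rcases le_total (a k) α with hlt | hlt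
    · have := h.real_levelSet_volume_mono (ha hk).1 hlt (by linarith [hα.2])
      linarith
    · have h1 := h.volume_levelSet_sub_le hα.1 hlt (ha hk).2 (by linarith)
      rw [← hQdef] at h1
      have h2 : (a k - α) / Q ≤ 2 * φ / Q := by
        gcongr
        linarith [hTmass k hk]
      linarith
  have hpos : {x | 0 < s x} = T K := by
    ext x
    rw [hs]
    exact overlayScore_pos_iff hT K x
  rw [hpos]
  refine ⟨?_, fun α hα hlt => ?_, fun α hα hle => ?_⟩
  · rw [← bK]
    exact hTmass K le_rfl
  · classical
    have hex : ∃ k, α < F.real (T k) := ⟨K, hlt⟩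
    have hk : Nat.find hex ≤ K := Nat.find_min' hex hlt
    have hspec := Nat.find_spec hex
    have hmin : ∀ i < Nat.find hex, F.real (T i) ≤ α := fun i hi => not_lt.1 (Nat.find_min hex hi)
    generalize Nat.find hex = k at hk hspec hmin
    rw [hs, massVolume_overlayScore vol F hT hk hα.1 hspec hmin]
    refine hTvol k hk α hα ?_
    have hφQ : 0 ≤ 2 * φ / Q := by positivity
    -- For `k = 0` the level `a 0 = 0` is already below `α`. Otherwise the preceding set has mass at
    -- most `α`, and a single leaf leads to the present one.
    cases k with
    | zero =>
      rw [b0]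
      have := h.real_levelSet_volume_mono le_rfl hα.1 (by linarith [hα.2])
      linarith
    | succ k =>
      have h1 := (bR k (by omega)).2
      have h2 := hcompare k (by omega) α hα (hmin k (by omega))
      linarith
  · refine hTvol K le_rfl α hα ?_
    have := hcompare K le_rfl α hα hle
    linarith

end IsNearOptimalFamily

end AnomalyRanking

/-! ### Rates of convergence. -/

namespace AnomalyRanking

variable {E : Type*} [MeasurableSpace E]

theorem rademacherAverage_nonneg (F : Measure E) (G : Set (Set E)) (n : ℕ) :
    0 ≤ rademacherAverage F G n :=
  integral_nonneg fun _ => div_nonneg (Finset.sum_nonneg fun _ _ =>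
    Real.iSup_nonneg fun _ => mul_nonneg (by positivity) (abs_nonneg _)) (by positivity)

theorem penalty_pos (F : Measure E) (G : Set (Set E)) {n : ℕ} (hn : 1 ≤ n) {δ : ℝ}
    (hδ : δ ∈ Ioo (0 : ℝ) 1) : 0 < penalty F G n δ := by
  have hn0 : (0 : ℝ) < n := by exact_mod_cast hn
  have hlog : 0 < Real.log (1 / δ) := Real.log_pos (by
    rw [lt_div_iff₀ hδ.1]; linarith [hδ.2])
  have h1 : 0 < Real.sqrt (Real.log (1 / δ) / (2 * n)) := Real.sqrt_pos.2 (by positivity)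
  have h2 := rademacherAverage_nonneg F G n
  rw [penalty]
  linarith

theorem penalty_le_of_rademacherAverage_le {F : Measure E} {G : Set (Set E)} {C : ℝ} {n : ℕ}
    (hR : rademacherAverage F G n ≤ C * (n : ℝ) ^ (-(1 / 2) : ℝ)) {δ : ℝ} :
    penalty F G n δ
      ≤ (2 * C + Real.sqrt (Real.log (1 / δ) / 2)) * (n : ℝ) ^ (-(1 / 2) : ℝ) := by
  have h : Real.sqrt (Real.log (1 / δ) / (2 * n))
      = Real.sqrt (Real.log (1 / δ) / 2) * (n : ℝ) ^ (-(1 / 2) : ℝ) := by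
    rw [← div_div, Real.sqrt_div' _ (Nat.cast_nonneg n), Real.rpow_neg (Nat.cast_nonneg n),
      ← Real.sqrt_eq_rpow, div_eq_mul_inv]
  rw [penalty, h]
  linarith

/-- Under the margin condition with exponent `γ`, a set which is optimal up to `2 φ` has volume of
order `φ ^ (γ / (1 + γ))` outside of the superlevel set. -/
theorem exists_volume_diff_levelSet_le_rpow {vol F : Measure E} [IsProbabilityMeasure F] {f : E → ℝ}
    (h : IsRegularDensity vol F f) {γ β : ℝ} (hγ : 0 ≤ γ) (hβ : β ∈ Ico (0 : ℝ) 1)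
    (hmargin : ∃ C t₀ : ℝ, 0 < C ∧ 0 < t₀ ∧ ∀ t : ℝ, 0 < t → t ≤ t₀ → ∀ q : ℝ, 0 < q →
      vol {x | |f x - q| ≤ t} ≤ ENNReal.ofReal (C * t ^ γ)) :
    ∃ C : ℝ, 0 < C ∧ ∀ (φ : ℝ) (Ωhat : ℝ → Set E), 0 < φ →
      IsNearOptimalFamily vol F f β (2 * φ) Ωhat → ∀ α ∈ Icc 0 β,
        vol.real (Ωhat α \ levelSet F f α) ≤ C * φ ^ (γ / (1 + γ)) := by
  obtain ⟨C, t₀, hC, ht₀, hm⟩ := hmargin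
  set V := vol.real (levelSet F f β)
  have hV : 0 ≤ V := measureReal_nonneg
  have hγ1 : (0 : ℝ) < 1 + γ := by linarith
  have ht₀γ : 0 < t₀ ^ γ := Real.rpow_pos_of_pos ht₀ _
  refine ⟨C + 2 + V / t₀ ^ γ, by positivity, fun φ Ωhat hφ hN α hα => ?_⟩
  have hα' : α ∈ Ico (0 : ℝ) 1 := ⟨hα.1, hα.2.trans_lt hβ.2⟩
  -- This `t` balances the band `t ^ γ` against `φ / t`. If `t > t₀` the margin condition says
  -- nothing, but then `φ ^ (γ / (1 + γ)) ≥ t₀ ^ γ`, and the term `V / t₀ ^ γ` of the constant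
  -- covers the trivial bound `V`.
  set t := φ ^ (1 / (1 + γ)) with ht
  have ht0 : 0 < t := Real.rpow_pos_of_pos hφ _
  have htγ : t ^ γ = φ ^ (γ / (1 + γ)) := by
    rw [ht, ← Real.rpow_mul hφ.le]
    congr 1
    ring
  have hφt : φ / t = φ ^ (γ / (1 + γ)) := by
    have : γ / (1 + γ) = 1 - 1 / (1 + γ) := by
      field_simp
      ring
    rw [this, Real.rpow_sub hφ, Real.rpow_one]
  have hp : 0 ≤ φ ^ (γ / (1 + γ)) := Real.rpow_nonneg hφ.le _
  have hVt : 0 ≤ V / t₀ ^ γ * φ ^ (γ / (1 + γ)) := by positivity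
  rcases le_or_gt t t₀ with hle | hlt
  · have hb := hm t ht0 hle (massInv F f α) (h.massInv_pos hα')
    have hband := ne_top_of_le_ne_top ENNReal.ofReal_ne_top hb
    have h1 := h.volume_diff_levelSet_le hα' ht0 (hN.measurable α hα) (hN.volume_le α hα)
      (hN.le_mass α hα) hband
    have h2 : vol.real {x | |f x - massInv F f α| ≤ t} ≤ C * t ^ γ :=
      ENNReal.toReal_le_of_le_ofReal (by positivity) hb
    rw [htγ] at h2
    have h3 : 2 * φ / t = 2 * φ ^ (γ / (1 + γ)) := by rw [mul_div_assoc, hφt]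
    rw [h3] at h1
    linarith
  · have hfin := h.volume_levelSet_ne_top hβ
    have h1 : vol (Ωhat α) ≤ vol (levelSet F f β) :=
      (hN.volume_le α hα).trans (measure_mono (h.levelSet_mono hα.1 hα.2 hβ.2))
    have h2 : vol.real (Ωhat α \ levelSet F f α) ≤ V :=
      ENNReal.toReal_mono hfin ((measure_mono sdiff_subset).trans h1)
    have h3 : t₀ ^ γ ≤ φ ^ (γ / (1 + γ)) := htγ ▸ Real.rpow_le_rpow ht₀.le hlt.le hγ
    have h4 : V ≤ V / t₀ ^ γ * φ ^ (γ / (1 + γ)) := by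
      rw [div_mul_eq_mul_div, le_div_iff₀ ht₀γ]
      gcongr
    have h5 : 0 ≤ (C + 2) * φ ^ (γ / (1 + γ)) := by positivity
    linarith

/-- When the empirical mass is uniformly close to the mass, solutions of the empirical minimum
volume set problems are nearly optimal. -/
theorem isNearOptimalFamily_of_uniformDeviation {vol F : Measure E} [IsProbabilityMeasure F]
    {f : E → ℝ} (h : IsRegularDensity vol F f) {G : Set (Set E)}
    (hGm : ∀ Ω ∈ G, MeasurableSet Ω) {β : ℝ} (hβ : β < 1)
    (hG_mv : ∀ α ∈ Icc (0 : ℝ) β, ∃ Ω ∈ G, IsMinVolumeSet vol F α Ω) {n : ℕ} {x : Fin n → E}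
    {φ : ℝ} (hdev : ∀ Ω ∈ G, |empMass x Ω - F.real Ω| ≤ φ) {Ωhat : ℝ → Set E}
    (hΩhat : ∀ α ∈ Icc (0 : ℝ) β, (∃ Ω, IsEmpFeasible G x φ α Ω) →
      IsEmpMinVolumeSet vol G x φ α (Ωhat α)) :
    IsNearOptimalFamily vol F f β (2 * φ) Ωhat := by
  have key : ∀ α ∈ Icc (0 : ℝ) β,
      Ωhat α ∈ G ∧ vol (Ωhat α) ≤ vol (levelSet F f α) ∧ α - 2 * φ ≤ F.real (Ωhat α) := by
    intro α hα
    obtain ⟨Ω, hΩG, -, hΩm, hΩv⟩ := hG_mv α hα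
    have hα' : α ∈ Ico (0 : ℝ) 1 := ⟨hα.1, hα.2.trans_lt hβ⟩
    -- One `φ` is lost in making the true minimum volume set feasible, another in passing from
    -- empirical mass back to mass.
    have hfeas : IsEmpFeasible G x φ α Ω := ⟨hΩG, by linarith [(abs_le.1 (hdev Ω hΩG)).1]⟩
    obtain ⟨⟨h1, h2⟩, h3⟩ := hΩhat α hα ⟨Ω, hfeas⟩
    refine ⟨h1, (h3 Ω hfeas).trans
      (hΩv _ (h.measurableSet_levelSet α) (h.real_levelSet hα').ge), ?_⟩
    linarith [(abs_le.1 (hdev _ h1)).2]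
  exact ⟨fun α hα => hGm _ (key α hα).1, fun α hα => (key α hα).2.1, fun α hα => (key α hα).2.2⟩

/-- Orders of magnitude of the terms of the error bound. -/
theorem error_terms_le {γ Q C₁ C₂ φ : ℝ} (hγ : 0 ≤ γ) (hQ : 0 < Q) (hC₁ : 0 ≤ C₁) (hC₂ : 0 ≤ C₂)
    {n : ℕ} (hn : 1 ≤ n) (hφ : 0 ≤ φ) (hφn : φ ≤ C₁ * (n : ℝ) ^ (-(1 / 2) : ℝ)) {r : ℝ}
    (hr : r = (n : ℝ) ^ (-(γ / (4 * (1 + γ))))) :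
    8 * φ / Q + r + 1 / (n * Q) + (2 + 2 / (Q * r)) * (C₂ * φ ^ (γ / (1 + γ)))
      ≤ (8 * C₁ / Q + 1 + 1 / Q + (2 + 2 / Q) * (C₂ * C₁ ^ (γ / (1 + γ)))) * r := by
  have hn1 : (1 : ℝ) ≤ n := by exact_mod_cast hn
  have hn0 : (0 : ℝ) < n := by linarith
  have hγ1 : (0 : ℝ) < 1 + γ := by linarith
  have hr0 : 0 < r := hr ▸ Real.rpow_pos_of_pos hn0 _
  have hκ : γ / (4 * (1 + γ)) ≤ 1 / 4 := by
    rw [div_le_div_iff₀ (by positivity) (by norm_num)]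
    linarith
  have hκ0 : 0 ≤ γ / (4 * (1 + γ)) := by positivity
  have hr1 : r ≤ 1 := hr ▸ Real.rpow_le_one_of_one_le_of_nonpos hn1 (by linarith)
  have hhalf : (n : ℝ) ^ (-(1 / 2) : ℝ) ≤ r :=
    hr ▸ Real.rpow_le_rpow_of_exponent_le hn1 (by linarith)
  have hinv : 1 / (n : ℝ) ≤ r := by
    rw [hr, one_div, ← Real.rpow_neg_one]
    exact Real.rpow_le_rpow_of_exponent_le hn1 (by linarith)
  have hφr : φ ≤ C₁ * r := hφn.trans (by gcongr)
  -- The excess volume is of order `r ^ 2`, so multiplying it by the number of leaves, of order `1 /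
  -- r`, leaves `r`: this fixes the exponent of `r`.
  have hpow : φ ^ (γ / (1 + γ)) ≤ C₁ ^ (γ / (1 + γ)) * r ^ 2 := by
    refine (Real.rpow_le_rpow hφ hφn (by positivity)).trans_eq ?_
    rw [Real.mul_rpow hC₁ (by positivity), ← Real.rpow_mul hn0.le, hr, ← Real.rpow_natCast,
      ← Real.rpow_mul hn0.le]
    congr 2
    push_cast
    field_simp
    ring
  have hD : 0 ≤ C₂ * C₁ ^ (γ / (1 + γ)) := mul_nonneg hC₂ (Real.rpow_nonneg hC₁ _)
  have t1 : 8 * φ / Q ≤ 8 * C₁ / Q * r := by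
    rw [div_mul_eq_mul_div, mul_assoc]
    gcongr
  have t2 : 1 / (n * Q) ≤ 1 / Q * r := by
    rw [← div_div, div_eq_mul_one_div, mul_comm]
    gcongr
  have t3 : (2 + 2 / (Q * r)) * (C₂ * φ ^ (γ / (1 + γ)))
      ≤ (2 + 2 / Q) * (C₂ * C₁ ^ (γ / (1 + γ))) * r := by
    calc (2 + 2 / (Q * r)) * (C₂ * φ ^ (γ / (1 + γ)))
        ≤ (2 + 2 / (Q * r)) * (C₂ * (C₁ ^ (γ / (1 + γ)) * r ^ 2)) := by gcongr
      _ = (2 * r + 2 / Q) * (C₂ * C₁ ^ (γ / (1 + γ))) * r := by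
          field_simp
      _ ≤ (2 + 2 / Q) * (C₂ * C₁ ^ (γ / (1 + γ))) * r := by
          gcongr
          linarith
  linarith

end AnomalyRanking

/-! ### The main theorem. -/

theorem theorem4 {d : ℕ} (𝒳 : Set (EuclideanSpace ℝ (Fin d))) (h𝒳 : MeasurableSet 𝒳)
    (vol F : Measure (EuclideanSpace ℝ (Fin d))) (hvol : vol = volume.restrict 𝒳)
    (f : EuclideanSpace ℝ (Fin d) → ℝ) (hf_meas : Measurable f) (hf_nonneg : ∀ x, 0 ≤ f x)
    [IsProbabilityMeasure F] (hF : F = vol.withDensity fun x => ENNReal.ofReal (f x))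
    {𝓞 : Type*} [MeasurableSpace 𝓞] (P : Measure 𝓞) [IsProbabilityMeasure P]
    (X : ℕ → 𝓞 → EuclideanSpace ℝ (Fin d)) (hX_meas : ∀ i, Measurable (X i))
    (hX_indep : iIndepFun X P) (hX_law : ∀ i, P.map (X i) = F)
    (ε δ γ : ℝ) (hε : ε ∈ Ioo (0 : ℝ) 1) (hδ : δ ∈ Ioo (0 : ℝ) 1) (hγ : 0 ≤ γ)
    (G : Set (Set (EuclideanSpace ℝ (Fin d))))
    (hG : ∀ Ω ∈ G, MeasurableSet Ω ∧ Ω ⊆ 𝒳 ∧ vol Ω < ⊤)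
    (hG_meas : AnomalyRanking.IsMeasurableClass G)
    -- the density is bounded and has no flat parts
    (hf_bdd : ∃ M : ℝ, ∀ x ∈ 𝒳, f x ≤ M)
    (hf_flat : ∀ t : ℝ, 0 < t → F {x | f x = t} = 0)
    -- the minimum volume sets of mass at most `1 - ε` are in the class
    (hG_mv : ∀ α ∈ Icc (0 : ℝ) (1 - ε), ∃ Ω ∈ G, AnomalyRanking.IsMinVolumeSet vol F α Ω)
    -- order of the Rademacher average
    (hG_rad : ∃ C : ℝ, 0 < C ∧ ∀ n : ℕ, 1 ≤ n →
      AnomalyRanking.rademacherAverage F G n ≤ C * (n : ℝ) ^ (-(1 / 2) : ℝ))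
    -- the optimal curve is differentiable on `[0,1)` with derivative `1 / Q*` in `L log L`
    (hMV_deriv : ∀ α ∈ Ico (0 : ℝ) 1,
      HasDerivWithinAt (fun a => (AnomalyRanking.massVolume vol F f a).toReal)
        (1 / AnomalyRanking.upperQuantile F f α) (Ico 0 1) α)
    (hMV_llogl : AnomalyRanking.MemLLogL fun α => 1 / AnomalyRanking.upperQuantile F f α)
    -- margin condition with exponent `γ`
    (hf_margin : ∃ C t₀ : ℝ, 0 < C ∧ 0 < t₀ ∧ ∀ t : ℝ, 0 < t → t ≤ t₀ → ∀ q : ℝ, 0 < q →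
      vol {x | |f x - q| ≤ t} ≤ ENNReal.ofReal (C * t ^ γ)) :
    ∃ C : ℝ, 0 < C ∧ ∀ n : ℕ, 1 ≤ n →
      ∀ φ : ℝ, φ = AnomalyRanking.penalty F G n δ →
      ∀ τ : ℝ, τ = 4 * φ / AnomalyRanking.upperQuantile F f (1 - ε)
          + (n : ℝ) ^ (-(γ / (4 * (1 + γ)))) →
      ∀ Ωhat : 𝓞 → ℝ → Set (EuclideanSpace ℝ (Fin d)),
      -- `Ωhat ω α` solves the empirical problem, whenever its constraint can be met
      (∀ᵐ ω ∂P, ∀ α ∈ Icc (0 : ℝ) (1 - ε),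
        (∃ Ω, AnomalyRanking.IsEmpFeasible G (fun i : Fin n => X i ω) φ α Ω) →
          AnomalyRanking.IsEmpMinVolumeSet vol G (fun i : Fin n => X i ω) φ α (Ωhat ω α)) →
      ∀ s : 𝓞 → EuclideanSpace ℝ (Fin d) → ℝ,
      (∀ ω, s ω = AnomalyRanking.aRankScore vol (Ωhat ω) ε τ n) →
      ∃ A : Set 𝓞, MeasurableSet A ∧ ENNReal.ofReal (1 - δ) ≤ P A ∧ ∀ ω ∈ A,
        1 - ε - 2 * φ ≤ F.real {x | 0 < s ω x} ∧
        (∀ α ∈ Icc (0 : ℝ) (1 - ε), α < F.real {x | 0 < s ω x} →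
          AnomalyRanking.massVolume vol F (s ω) α ≤ AnomalyRanking.massVolume vol F f α
            + ENNReal.ofReal (C * (n : ℝ) ^ (-(γ / (4 * (1 + γ)))))) ∧
        (∀ α ∈ Icc (0 : ℝ) (1 - ε), F.real {x | 0 < s ω x} ≤ α →
          vol {x | 0 < s ω x} ≤ AnomalyRanking.massVolume vol F f α
            + ENNReal.ofReal (C * (n : ℝ) ^ (-(γ / (4 * (1 + γ)))))) := by
  have hvolae : ∀ᵐ x ∂vol, x ∈ 𝒳 := hvol ▸ ae_restrict_mem h𝒳
  have h : AnomalyRanking.IsRegularDensity vol F f :=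
    ⟨hf_meas, hf_nonneg, hF, hf_flat, hf_bdd.imp fun M hM => hvolae.mono hM⟩
  have hε1 : (1 - ε) ∈ Ico (0 : ℝ) 1 := ⟨by linarith [hε.2], by linarith [hε.1]⟩
  have hGm : ∀ Ω ∈ G, MeasurableSet Ω := fun Ω hΩ => (hG Ω hΩ).1
  obtain ⟨CR, hCR, hRad⟩ := hG_rad
  obtain ⟨C₂, hC₂, hexc⟩ :=
    AnomalyRanking.exists_volume_diff_levelSet_le_rpow h hγ hε1 hf_margin
  have hQ := h.massInv_pos hε1
  have hQeq := h.upperQuantile_eq_massInv hε1.2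
  set Q := AnomalyRanking.massInv F f (1 - ε) with hQdef
  set C₁ := 2 * CR + Real.sqrt (Real.log (1 / δ) / 2) with hC₁def
  have hC₁ : 0 ≤ C₁ := by positivity
  refine ⟨8 * C₁ / Q + 1 + 1 / Q + (2 + 2 / Q) * (C₂ * C₁ ^ (γ / (1 + γ))), by positivity, ?_⟩
  intro n hn φ hφ τ hτ Ωhat hΩhat s hs
  have hn0 : (0 : ℝ) < n := by exact_mod_cast hn
  have hφ0 : 0 < φ := hφ ▸ AnomalyRanking.penalty_pos F G hn hδ
  have hφn : φ ≤ C₁ * (n : ℝ) ^ (-(1 / 2) : ℝ) :=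
    hφ ▸ AnomalyRanking.penalty_le_of_rademacherAverage_le (hRad n hn)
  obtain ⟨B, hBm, hBP, hB⟩ :=
    AnomalyRanking.exists_uniformDeviation_event F hG_meas hGm hn hδ
  have hmap : P.map (fun ω (i : Fin n) => X i ω) = Measure.pi fun _ => F := by
    have hind : iIndepFun (fun i : Fin n => X i) P := hX_indep.precomp Fin.val_injective
    rw [(iIndepFun_iff_map_fun_eq_pi_map fun i : Fin n => (hX_meas i).aemeasurable).1 hind]
    simp only [hX_law]
  have hXm : Measurable fun ω (i : Fin n) => X i ω := measurable_pi_lambda _ fun i => hX_meas i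
  -- The sets `Ωhat ω α` solve the empirical problems only almost surely; a measurable null set
  -- containing the exceptions is removed from the event.
  obtain ⟨N, hNsub, hNm, hN0⟩ := exists_measurable_superset_of_null hΩhat
  refine ⟨(fun ω (i : Fin n) => X i ω) ⁻¹' B \ N, (hXm hBm).diff hNm, ?_, fun ω hω => ?_⟩
  · rw [measure_sdiff_null hN0, ← Measure.map_apply hXm hBm, hmap]
    exact hBP
  · have hsol : ∀ α ∈ Icc (0 : ℝ) (1 - ε),
        (∃ Ω, AnomalyRanking.IsEmpFeasible G (fun i : Fin n => X i ω) φ α Ω) →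
          AnomalyRanking.IsEmpMinVolumeSet vol G (fun i : Fin n => X i ω) φ α (Ωhat ω α) := by
      by_contra hcon
      exact hω.2 (hNsub hcon)
    have hnear := AnomalyRanking.isNearOptimalFamily_of_uniformDeviation h hGm hε1.2 hG_mv
      (fun Ω hΩ => hφ ▸ hB _ hω.1 Ω hΩ) hsol
    refine hnear.aRankScore_bounds h hε.1 hε.2 hφ0.le (Real.rpow_pos_of_pos hn0 _) hn
      (hexc φ _ hφ0 hnear) hQdef (by rw [hs ω, hτ, hQeq]) ?_
    exact AnomalyRanking.error_terms_le hγ hQ hC₁ hC₂.le hn hφ0.le hφn rfl
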